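/- Consider a group-server queue: customers arrive in a Poisson stream of rate $\lambda>0$ to a station with infinite waiting room and $K\ge 1$ groups of parallel servers; group $k$ has $M_k\ge 1$ servers, each of which, when on, serves at exponential rate $\mu_k>0$ and costs $c_k$ per unit of time, and $(\mu_k,c_k)\ne(\mu_l,c_l)$ for $k\neq l$. The state $n$ is the number of customers in the system. A (stationary, efficient) policy $d$ chooses in each state $n\in\mathbb N$ numbers $d(n,k)\in\{0,\dots,M_k\}$ of working servers with $\sum_k d(n,k)\le n$, so that the number $n_t$ of customers at time $t$ is a birth–death process with birth rate $\lambda$ and death rate $\sum_k d(n,k)\mu_k$ in state $n$. Its long-run average cost is $$\eta^d=\lim_{T\to\infty}\mathbb E\Big\{\frac1T\int_0^T\Big(h(n_t)+\sum_k d(n_t,k)c_k\Big)\,dt\Big\},$$ where the holding cost $h:\mathbb N\to\mathbb R$ is increasing (not necessarily strictly), convex, and $h(n)\to\infty$ as $n\to\infty$. A policy is optimal if $\eta^d$ is finite (the limit existing with the same value for every initial state) and minimal among all efficient policies. Assume scale economies: $\frac{c_1}{\mu_1}\le\dots\le\frac{c_K}{\mu_K}$ and $\mu_1\ge\dots\ge\mu_K$.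 A vector $\theta=(\theta_1,\dots,\theta_K)$ of positive integers with $\theta_1\le\dots\le\theta_K$ determines the threshold policy given recursively in $k$ by $d(n,k)=\min\{M_k,\;n-\sum_{l<k}d(n,l)\}$ if $n\ge\theta_k$, and $d(n,k)=0$ if $n<\theta_k$; it is an optimal threshold vector if the average cost of this policy is finite and minimal among all such vectors. Then the optimal threshold of group 1 (the most efficient group) is always $\theta_1^*=1$, that is, group 1 is used whenever any customer is present. Precisely: 1. every optimal threshold vector $\theta^*$ has $\theta_1^*=1$; 2. if $d^*$ is an optimal policy, $\eta^*$ its average cost, $g^*$ a performance potential of it (a solution of the Poisson equation $h(n)+\sum_k d^*(n,k)c_k-\eta^*+\lambda\,(g^*(n+1)-g^*(n))+\sum_k d^*(n,k)\mu_k\,(g^*(n-1)-g^*(n))=0$ for all $n\ge0$, the last term being absent for $n=0$), and $G^*(n)=g^*(n)-g^*(n-1)$ for $n\ge1$, then $\min\{n\ge1: G^*(n)>c_1/\mu_1\}=1$; 3. every optimal policy $d^*$ satisfies $d^*(n,1)=\min\{M_1,n\}$ for all $n\ge1$. -/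

import Mathlib

open Filter Topology

noncomputable section

/-- The data of a group-server queue with `K` groups of parallel servers. Group `k` consists of
`M k` servers; each of them, while working, serves at the exponential rate `mu k` and costs `c k`
per unit of time. Customers arrive in a Poisson stream of rate `lam`, and `h n` is the holding
cost per unit of time while `n` customers are present. -/
structure GroupQueue (K : ℕ) where
  lam : ℝ
  M : Fin K → ℕ
  mu : Fin K → ℝ
  c : Fin K → ℝ
  h : ℕ → ℝ

namespace GroupQueue

variable {K : ℕ}

/-- Standing assumptions of the model: positive rates, nonempty groups, servers of different
groups are not identical, and the holding cost is (weakly) increasing, convex, and tends to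
infinity. -/
structure Standing (Q : GroupQueue K) : Prop where
  lam_pos : 0 < Q.lam
  mu_pos : ∀ k, 0 < Q.mu k
  M_pos : ∀ k, 1 ≤ Q.M k
  heterogeneous : Function.Injective fun k => (Q.mu k, Q.c k)
  h_mono : Monotone Q.h
  h_convex : ∀ n, Q.h (n + 1) - Q.h n ≤ Q.h (n + 2) - Q.h (n + 1)
  h_tendsto : Tendsto Q.h atTop atTop

/-- Scale economies: the groups are numbered in ascending order of `c / mu` (so the first group is
the most efficient one), and in this order the service rates are decreasing. -/
structure ScaleEconomies (Q : GroupQueue K) : Prop where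
  ratio_mono : Monotone fun k => Q.c k / Q.mu k
  mu_anti : Antitone Q.mu

/-- A stationary scheduling policy: `d n k` is the number of working servers of group `k` while
`n` customers are in the system. -/
abbrev Policy (K : ℕ) : Type := ℕ → Fin K → ℕ

/-- The efficient policies: in every state `n` at most `M k` servers of group `k` work, and at
most `n` servers work in total. -/
def efficientPolicies (Q : GroupQueue K) : Set (Policy K) :=
  {d | ∀ n, (∀ k, d n k ≤ Q.M k) ∧ ∑ k, d n k ≤ n}

/-- The total service rate of the action `m`. -/
def serviceRate (Q : GroupQueue K) (m : Fin K → ℕ) : ℝ := ∑ k, (m k : ℝ) * Q.mu k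

/-- The total cost rate `f(n, m)`: holding cost plus operating cost. -/
def cost (Q : GroupQueue K) (n : ℕ) (m : Fin K → ℕ) : ℝ := Q.h n + ∑ k, (m k : ℝ) * Q.c k

/-- The infinitesimal generator of the birth-death process `n_t` (number of customers) under the
policy `d`, acting on functions of the state: births at rate `lam`, deaths at rate
`serviceRate (d n)`. In state `0` the second term is zero. -/
def gen (Q : GroupQueue K) (d : Policy K) : Module.End ℝ (ℕ → ℝ) where
  toFun g := fun n => Q.lam * (g (n + 1) - g n) + Q.serviceRate (d n) * (g (n - 1) - g n)
  map_add' g g' := by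
    funext n
    simp only [Pi.add_apply]
    ring
  map_smul' r g := by
    funext n
    simp only [Pi.smul_apply, smul_eq_mul, RingHom.id_apply]
    ring

/-- The transition probability `P(n_t = j | n_0 = i)` under the policy `d`, that is, the
`(i, j)` entry of `exp (t B)`, where `B` is the generator (whose entries are bounded). -/
def transProb (Q : GroupQueue K) (d : Policy K) (t : ℝ) (i j : ℕ) : ℝ :=
  ∑' r : ℕ, t ^ r / (r.factorial : ℝ) * ((Q.gen d ^ r) (Pi.single j 1)) i

/-- The expected cost rate `E[f(n_t, d(n_t)) | n_0 = i]` at time `t`. -/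
def expCost (Q : GroupQueue K) (d : Policy K) (i : ℕ) (t : ℝ) : ℝ :=
  ∑' j, Q.transProb d t i j * Q.cost j (d j)

/-- The policy `d` has the finite long-run average cost `a`: whatever the initial state `i`, the
expected costs are finite and `(1 / T) E[∫₀ᵀ f(n_t, d(n_t)) dt | n_0 = i]` tends to `a`. -/
def HasAverageCost (Q : GroupQueue K) (d : Policy K) (a : ℝ) : Prop :=
  ∀ i : ℕ,
    (∀ t : ℝ, 0 ≤ t → Summable fun j => Q.transProb d t i j * Q.cost j (d j)) ∧
    (∀ T : ℝ, 0 ≤ T → IntervalIntegrable (Q.expCost d i) MeasureTheory.volume 0 T) ∧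
    Tendsto (fun T : ℝ => 1 / T * ∫ t in (0 : ℝ)..T, Q.expCost d i t) atTop (𝓝 a)

/-- `d` is optimal: it is efficient, its long-run average cost is finite, and it is minimal among
those of all efficient policies. (A policy without a finite average cost has cost `+∞`.) -/
def IsOptimal (Q : GroupQueue K) (d : Policy K) : Prop :=
  d ∈ Q.efficientPolicies ∧ ∃ a, Q.HasAverageCost d a ∧
    ∀ d' ∈ Q.efficientPolicies, ∀ a', Q.HasAverageCost d' a' → a ≤ a'

/-- `g` is a performance potential (relative value function) of the policy `d` with average cost
`a`, that is, it solves the Poisson equation `f - a + B g = 0`. -/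
def IsPotential (Q : GroupQueue K) (d : Policy K) (a : ℝ) (g : ℕ → ℝ) : Prop :=
  ∀ n, Q.cost n (d n) - a + Q.gen d g n = 0

/-- The action in state `n` of the multi-threshold policy with thresholds `θ`: once `θ k ≤ n`,
group `k` uses as many servers as it has and as the lower-numbered groups leave customers for;
below its threshold it is off. -/
def thresholdPolicy (Q : GroupQueue K) (θ : Fin K → ℕ) (n : ℕ) (k : Fin K) : ℕ :=
  if θ k ≤ n then
    min (Q.M k) (n - ∑ l ∈ (Finset.Iio k).attach, thresholdPolicy Q θ n l.1)
  else 0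
termination_by k.val
decreasing_by
  have hl := Finset.mem_Iio.mp l.2
  exact hl

theorem thresholdPolicy_eq (Q : GroupQueue K) (θ : Fin K → ℕ) (n : ℕ) (k : Fin K) :
    Q.thresholdPolicy θ n k =
      if θ k ≤ n then min (Q.M k) (n - ∑ l ∈ Finset.Iio k, Q.thresholdPolicy θ n l) else 0 := by
  rw [thresholdPolicy, Finset.sum_attach (Finset.Iio k) (fun l => Q.thresholdPolicy θ n l)]

/-- The admissible threshold vectors: positive and increasing in the group index. -/
def thresholdVectors (K : ℕ) : Set (Fin K → ℕ) := {θ | (∀ k, 1 ≤ θ k) ∧ Monotone θ}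

/-- `θ` is an optimal threshold vector: the policy it determines has a finite long-run average
cost, minimal among those of all admissible threshold vectors. -/
def IsOptimalThreshold (Q : GroupQueue K) (θ : Fin K → ℕ) : Prop :=
  θ ∈ thresholdVectors K ∧ ∃ a, Q.HasAverageCost (Q.thresholdPolicy θ) a ∧
    ∀ θ' ∈ thresholdVectors K, ∀ a', Q.HasAverageCost (Q.thresholdPolicy θ') a' → a ≤ a'

end GroupQueue

end

/-!
Refund service at the price `p = c₁ / μ₁`. In a steady state the mean service rate is the
arrival rate `λ`, so a refund of `p` per unit of service beyond the rate `λ` leaves the average cost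
`η` unchanged. After the refund a server of group 1 costs nothing, and a server of any other group
costs nothing or more. Let the excess of a state be its cost rate with refund, minus `η`; its
stationary mean is zero.

Fix a state `m > 0` and consider the total excess, weighted by the stationary distribution, of the
states below `m`.

* If it is not negative, then `h m + p λ < η`, since otherwise the states from `m` on would make the
  mean positive. Using group 1 only, as much as possible, up to state `m` then gives the states
  below `m` a negative excess, does not raise that of `m`, and changes the stationary weights from
  `m` on by a constant factor only. Hence it lowers the average cost.
* If it is negative, then serving faster in `m` without a higher excess, or at the same rate with a
  lower one, lowers the average cost, since it shifts mass to the states below `m` or lowers the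
  mean directly. When group 1 is not fully used in `m`, starting an idle server of group 1, or
  replacing a server of another group by it, is such a change.

So an optimal policy is always in the second case, and uses group 1 fully. The bound in the first
case also holds for `m = 0`; inserted into the Poisson equation in state `0` it is `p < G 1`. For a
threshold policy the stationary distribution starts at `m = θ₁ - 1`, which puts it in the first case
if `θ₁ > 1`; the improved policy is then the threshold policy with `θ₁` replaced by `1`.
-/

section OperatorExponential

variable {E F : Type*} [NormedAddCommGroup E] [NormedSpace ℝ E]
  [NormedAddCommGroup F] [NormedSpace ℝ F]

/-- The operator semigroup `exp (t A)` generated by a bounded operator `A`. -/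
noncomputable def expSemigroup (A : E →L[ℝ] E) (t : ℝ) : E →L[ℝ] E := NormedSpace.exp (t • A)

theorem expSemigroup_zero (A : E →L[ℝ] E) : expSemigroup A 0 = 1 := by
  simp [expSemigroup, NormedSpace.exp_zero]

variable [CompleteSpace E]

theorem hasSum_map_expSemigroup (A : E →L[ℝ] E) (φ : E →L[ℝ] F) (g : E) (t : ℝ) :
    HasSum (fun r : ℕ => (t ^ r / (r.factorial : ℝ)) • φ ((A ^ r) g))
      (φ (expSemigroup A t g)) := by
  have h := NormedSpace.exp_series_hasSum_exp' (𝕂 := ℝ) (t • A)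
  convert (h.mapL (ContinuousLinearMap.apply ℝ E g)).mapL φ using 2 with r
  · simp [smul_pow, smul_smul, div_eq_inv_mul]
  · rfl

theorem hasDerivAt_map_expSemigroup (A : E →L[ℝ] E) (φ : E →L[ℝ] F) (g : E) (t : ℝ) :
    HasDerivAt (fun t : ℝ => φ (expSemigroup A t g))
      (φ (expSemigroup A t (A g))) t :=
  φ.hasFDerivAt.comp_hasDerivAt t
    ((ContinuousLinearMap.apply ℝ E g).hasFDerivAt.comp_hasDerivAt t
      (hasDerivAt_exp_smul_const (𝕂 := ℝ) A t))

theorem map_expSemigroup_eq {A : E →L[ℝ] E} {φ : E →L[ℝ] F} {g : E}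
    (h : ∀ r : ℕ, φ ((A ^ (r + 1)) g) = 0) (t : ℝ) : φ (expSemigroup A t g) = φ g := by
  refine (hasSum_map_expSemigroup A φ g t).unique ?_
  convert hasSum_single 0 fun r hr => ?_ using 1
  · simp
  · obtain ⟨k, rfl⟩ := Nat.exists_eq_succ_of_ne_zero hr
    rw [h, smul_zero]

theorem expSemigroup_eq_smul_expSemigroup_add (A : E →L[ℝ] E) (c t : ℝ) :
    expSemigroup A t = Real.exp (-(t * c)) • expSemigroup (A + c • 1) t := by
  let _ : NormedAlgebra ℚ (E →L[ℝ] E) := NormedAlgebra.restrictScalars ℚ ℝ (E →L[ℝ] E)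
  have hsplit : t • A = (-(t * c)) • (1 : E →L[ℝ] E) + t • (A + c • 1) := by
    module
  have hcomm : Commute ((-(t * c)) • (1 : E →L[ℝ] E)) (t • (A + c • 1)) :=
    (Commute.one_left _).smul_left _
  have hexp : NormedSpace.exp ((-(t * c)) • (1 : E →L[ℝ] E)) = Real.exp (-(t * c)) • 1 := by
    have := NormedSpace.algebraMap_exp_comm (𝕂 := ℝ) (𝔸 := E →L[ℝ] E) (-(t * c))
    rw [Algebra.algebraMap_eq_smul_one, Algebra.algebraMap_eq_smul_one] at this
    rw [← this, Real.exp_eq_exp_ℝ]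
  rw [expSemigroup, expSemigroup, hsplit, NormedSpace.exp_add_of_commute hcomm, hexp, smul_one_mul]

end OperatorExponential

open scoped BoundedContinuousFunction

/-- A birth-death process on `ℕ` with bounded rates: in state `n`, births occur at rate `birth n`
and deaths at rate `death n`, and `rate` bounds the total jump rate. The value `death 0` is
irrelevant, since a death in state `0` leads to `0 - 1 = 0`. -/
structure BirthDeath where
  birth : ℕ → ℝ
  death : ℕ → ℝ
  rate : ℝ
  birth_nonneg : ∀ n, 0 ≤ birth n
  death_nonneg : ∀ n, 0 ≤ death n
  birth_add_death_le : ∀ n, birth n + death n ≤ rate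

namespace BirthDeath

section Semigroup

variable (X : BirthDeath)

theorem rate_nonneg : 0 ≤ X.rate :=
  (add_nonneg (X.birth_nonneg 0) (X.death_nonneg 0)).trans (X.birth_add_death_le 0)

theorem norm_birth_add_death_le (g : ℕ →ᵇ ℝ) (n : ℕ) :
    ‖X.birth n * (g (n + 1) - g n) + X.death n * (g (n - 1) - g n)‖ ≤ 2 * X.rate * ‖g‖ := by
  have hdiff : ∀ a b, ‖g a - g b‖ ≤ 2 * ‖g‖ := fun a b =>
    (norm_sub_le _ _).trans
      (by linarith [g.norm_coe_le_norm a, g.norm_coe_le_norm b])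
  calc _ ≤ X.birth n * ‖g (n + 1) - g n‖ + X.death n * ‖g (n - 1) - g n‖ := by
        refine (norm_add_le _ _).trans_eq ?_
        rw [norm_mul, norm_mul, Real.norm_of_nonneg (X.birth_nonneg n),
          Real.norm_of_nonneg (X.death_nonneg n)]
    _ ≤ X.birth n * (2 * ‖g‖) + X.death n * (2 * ‖g‖) :=
        add_le_add (mul_le_mul_of_nonneg_left (hdiff _ _) (X.birth_nonneg n))
          (mul_le_mul_of_nonneg_left (hdiff _ _) (X.death_nonneg n))
    _ ≤ 2 * X.rate * ‖g‖ := by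
        nlinarith [mul_le_mul_of_nonneg_right (X.birth_add_death_le n) (norm_nonneg g)]

/-- The infinitesimal generator, as a bounded operator on the bounded functions of the state. -/
noncomputable def generator : (ℕ →ᵇ ℝ) →L[ℝ] (ℕ →ᵇ ℝ) :=
  LinearMap.mkContinuous
    { toFun := fun g => BoundedContinuousFunction.ofNormedAddCommGroupDiscrete
        (fun n => X.birth n * (g (n + 1) - g n) + X.death n * (g (n - 1) - g n))
        (2 * X.rate * ‖g‖) (X.norm_birth_add_death_le g)
      map_add' := fun g g' => by
        ext n
        simp only [BoundedContinuousFunction.coe_ofNormedAddCommGroupDiscrete,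
          BoundedContinuousFunction.add_apply]
        ring
      map_smul' := fun r g => by
        ext n
        simp only [BoundedContinuousFunction.coe_ofNormedAddCommGroupDiscrete,
          BoundedContinuousFunction.smul_apply, smul_eq_mul, RingHom.id_apply]
        ring }
    (2 * X.rate) fun g =>
      (BoundedContinuousFunction.norm_le
        (mul_nonneg (mul_nonneg zero_le_two X.rate_nonneg) (norm_nonneg g))).2
        (X.norm_birth_add_death_le g)

theorem generator_apply (g : ℕ →ᵇ ℝ) (n : ℕ) :
    X.generator g n = X.birth n * (g (n + 1) - g n) + X.death n * (g (n - 1) - g n) := rfl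

/-- The transition semigroup on the bounded functions of the state: `semigroup t g i` is the
expectation of `g` at time `t` when the process starts in `i`. -/
noncomputable def semigroup (t : ℝ) : (ℕ →ᵇ ℝ) →L[ℝ] (ℕ →ᵇ ℝ) := expSemigroup X.generator t

theorem semigroup_zero_apply (g : ℕ →ᵇ ℝ) : X.semigroup 0 g = g := by
  simp [semigroup, expSemigroup_zero]

theorem hasDerivAt_semigroup_apply (g : ℕ →ᵇ ℝ) (i : ℕ) (t : ℝ) :
    HasDerivAt (fun t => X.semigroup t g i) (X.semigroup t (X.generator g) i) t :=
  hasDerivAt_map_expSemigroup X.generator (BoundedContinuousFunction.evalCLM ℝ i) g t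

-- Adding `rate` to the generator makes it a positive operator, and so are its powers.
theorem semigroup_apply_nonneg {g : ℕ →ᵇ ℝ} (hg : ∀ n, 0 ≤ g n) {t : ℝ} (ht : 0 ≤ t) (i : ℕ) :
    0 ≤ X.semigroup t g i := by
  set N : (ℕ →ᵇ ℝ) →L[ℝ] (ℕ →ᵇ ℝ) := X.generator + X.rate • 1
  have hN : ∀ f : ℕ →ᵇ ℝ, (∀ n, 0 ≤ f n) → ∀ n, 0 ≤ N f n := fun f hf n => by
    have heq : N f n = X.birth n * f (n + 1) + X.death n * f (n - 1)
        + (X.rate - (X.birth n + X.death n)) * f n := by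
      change X.generator f n + X.rate * f n = _
      rw [generator_apply]
      ring
    have := X.birth_nonneg n
    have := X.death_nonneg n
    have := sub_nonneg.2 (X.birth_add_death_le n)
    have := hf (n + 1)
    have := hf (n - 1)
    have := hf n
    rw [heq]
    positivity
  have hpow : ∀ r n, 0 ≤ (N ^ r) g n := fun r => by
    induction r with
    | zero => exact hg
    | succ r ih => rw [pow_succ']; exact hN _ ih
  rw [semigroup, expSemigroup_eq_smul_expSemigroup_add _ X.rate t]
  exact mul_nonneg (Real.exp_pos _).le
    ((hasSum_map_expSemigroup N (BoundedContinuousFunction.evalCLM ℝ i) g t).nonneg fun r =>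
      mul_nonneg (by positivity) (hpow r i))

theorem semigroup_apply_mono {f g : ℕ →ᵇ ℝ} (hfg : ∀ n, f n ≤ g n) {t : ℝ} (ht : 0 ≤ t) (i : ℕ) :
    X.semigroup t f i ≤ X.semigroup t g i := by
  have h := X.semigroup_apply_nonneg (g := g - f) (fun n => sub_nonneg.2 (hfg n)) ht i
  rwa [map_sub, BoundedContinuousFunction.sub_apply, sub_nonneg] at h

theorem semigroup_apply_one (t : ℝ) (i : ℕ) : X.semigroup t 1 i = 1 := by
  have hgen : X.generator 1 = 0 := by
    ext n
    simp [generator_apply]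
  refine map_expSemigroup_eq (A := X.generator) (φ := BoundedContinuousFunction.evalCLM ℝ i)
    (fun r => ?_) t
  rw [pow_succ, mul_apply_eq_comp, hgen, map_zero, map_zero]

/-- The indicator function of a set of states. -/
noncomputable def ind (s : Set ℕ) : ℕ →ᵇ ℝ :=
  BoundedContinuousFunction.indicator s (isClopen_discrete s)

theorem ind_apply (s : Set ℕ) (n : ℕ) : ind s n = s.indicator 1 n := rfl

/-- The transition probability from `i` to `j` in time `t`. -/
noncomputable def transProb (t : ℝ) (i j : ℕ) : ℝ := X.semigroup t (ind {j}) i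

theorem transProb_nonneg {t : ℝ} (ht : 0 ≤ t) (i j : ℕ) : 0 ≤ X.transProb t i j :=
  X.semigroup_apply_nonneg (fun _ => Set.indicator_nonneg (fun _ _ => zero_le_one) _) ht i

theorem transProb_zero (i j : ℕ) : X.transProb 0 i j = if i = j then 1 else 0 := by
  simp [transProb, semigroup_zero_apply, ind_apply, Set.indicator_apply]

theorem continuous_transProb (i j : ℕ) : Continuous fun t => X.transProb t i j :=
  continuous_iff_continuousAt.2 fun t => (X.hasDerivAt_semigroup_apply _ i t).continuousAt

theorem intervalIntegrable_transProb (i j : ℕ) (a b : ℝ) :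
    IntervalIntegrable (fun t => X.transProb t i j) MeasureTheory.volume a b :=
  (X.continuous_transProb i j).intervalIntegrable a b

theorem sum_transProb_eq_semigroup_apply (t : ℝ) (i n : ℕ) :
    ∑ j ∈ Finset.range n, X.transProb t i j = X.semigroup t (ind (Set.Iio n)) i := by
  have h : ind (Set.Iio n) = ∑ j ∈ Finset.range n, ind {j} := by
    ext m
    simp [ind_apply, Set.indicator_apply]
  simp [h, transProb]

theorem sum_transProb_le_one {t : ℝ} (ht : 0 ≤ t) (i n : ℕ) :
    ∑ j ∈ Finset.range n, X.transProb t i j ≤ 1 := by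
  rw [sum_transProb_eq_semigroup_apply, ← X.semigroup_apply_one t i]
  exact X.semigroup_apply_mono
    (fun m => Set.indicator_le_self' (f := (1 : ℕ → ℝ)) (fun _ _ => zero_le_one) m) ht i

theorem sum_transProb_nonneg {t : ℝ} (ht : 0 ≤ t) (i n : ℕ) :
    0 ≤ ∑ j ∈ Finset.range n, X.transProb t i j :=
  Finset.sum_nonneg fun j _ => X.transProb_nonneg ht i j

theorem generator_ind_Iio (n : ℕ) :
    X.generator (ind (Set.Iio (n + 1))) =
      X.death (n + 1) • ind {n + 1} - X.birth n • ind {n} := by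
  ext m
  obtain hm | rfl | rfl | hm : m < n ∨ m = n ∨ m = n + 1 ∨ n + 1 < m := by omega
  · simp [generator_apply, ind_apply, Set.indicator_apply, hm.ne, hm, show m ≠ n + 1 by omega,
      show m < n + 1 by omega, show m - 1 < n + 1 by omega]
  · simp [generator_apply, ind_apply, Set.indicator_apply, show m - 1 < m + 1 by omega]
  · simp [generator_apply, ind_apply, Set.indicator_apply]
  · simp [generator_apply, ind_apply, Set.indicator_apply, hm.ne', show ¬ m < n by omega,
      show ¬ m < n + 1 by omega, show ¬ m - 1 < n + 1 by omega, show m ≠ n by omega]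

/-- Kolmogorov's forward equation, summed over the states `0, …, n`. -/
theorem hasDerivAt_sum_transProb (i n : ℕ) (t : ℝ) :
    HasDerivAt (fun t => ∑ j ∈ Finset.range (n + 1), X.transProb t i j)
      (X.death (n + 1) * X.transProb t i (n + 1) - X.birth n * X.transProb t i n) t := by
  simp only [sum_transProb_eq_semigroup_apply]
  convert X.hasDerivAt_semigroup_apply (ind (Set.Iio (n + 1))) i t using 1
  rw [generator_ind_Iio, map_sub, map_smul, map_smul]
  rfl

theorem sum_transProb_sub_eq_integral (i n : ℕ) (T : ℝ) :
    ∑ j ∈ Finset.range (n + 1), X.transProb T i j - ∑ j ∈ Finset.range (n + 1), X.transProb 0 i j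
      = X.death (n + 1) * (∫ t in (0 : ℝ)..T, X.transProb t i (n + 1))
        - X.birth n * ∫ t in (0 : ℝ)..T, X.transProb t i n := by
  have hint := fun j c => (X.intervalIntegrable_transProb i j 0 T).const_mul c
  rw [← intervalIntegral.integral_const_mul, ← intervalIntegral.integral_const_mul,
    ← intervalIntegral.integral_sub (hint _ _) (hint _ _)]
  exact (intervalIntegral.integral_eq_sub_of_hasDerivAt
    (fun t _ => X.hasDerivAt_sum_transProb i n t) ((hint _ _).sub (hint _ _))).symm

theorem integral_transProb_nonneg {T : ℝ} (hT : 0 ≤ T) (i j : ℕ) :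
    0 ≤ ∫ t in (0 : ℝ)..T, X.transProb t i j :=
  intervalIntegral.integral_nonneg hT fun _ ht => X.transProb_nonneg ht.1 i j

theorem summable_integral_transProb {T : ℝ} (hT : 0 ≤ T) (i : ℕ) :
    Summable fun j => ∫ t in (0 : ℝ)..T, X.transProb t i j := by
  refine summable_of_sum_range_le (c := T) (X.integral_transProb_nonneg hT i) fun n => ?_
  rw [← intervalIntegral.integral_finsetSum fun j _ => X.intervalIntegrable_transProb i j 0 T]
  calc _ ≤ ∫ _ in (0 : ℝ)..T, (1 : ℝ) :=
        intervalIntegral.integral_mono_on hT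
          ((continuous_finsetSum _ fun j _ => X.continuous_transProb i j).intervalIntegrable _ _)
          (continuous_const.intervalIntegrable _ _) fun t ht => X.sum_transProb_le_one ht.1 i n
    _ = T := by simp

-- By the forward equation the mass beyond `n` at time `t` is at most `birth n` times the expected
-- time spent in `n`, and these times are summable over `n`.
theorem hasSum_transProb {t : ℝ} (ht : 0 ≤ t) (i : ℕ) : HasSum (X.transProb t i) 1 := by
  rw [hasSum_iff_tendsto_nat_of_nonneg (fun j => X.transProb_nonneg ht i j),
    ← tendsto_add_atTop_iff_nat 1]
  have hlow : Tendsto (fun n => 1 - X.rate * ∫ u in (0 : ℝ)..t, X.transProb u i n) atTop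
      (𝓝 1) := by
    have hzero := (X.summable_integral_transProb ht i).tendsto_atTop_zero
    simpa using (hzero.const_mul X.rate).const_sub 1
  refine tendsto_of_tendsto_of_tendsto_of_le_of_le' hlow tendsto_const_nhds ?_
    (Eventually.of_forall fun n => X.sum_transProb_le_one ht i (n + 1))
  filter_upwards [eventually_ge_atTop i] with n hn
  have hstart : ∑ j ∈ Finset.range (n + 1), X.transProb 0 i j = 1 := by
    simp only [transProb_zero, Finset.sum_ite_eq, Finset.mem_range]
    rw [if_pos (by omega)]
  have hbirth : X.birth n ≤ X.rate := by
    linarith [X.birth_add_death_le n, X.death_nonneg n]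
  linarith [X.sum_transProb_sub_eq_integral i n t,
    mul_nonneg (X.death_nonneg (n + 1)) (X.integral_transProb_nonneg ht i (n + 1)),
    mul_le_mul_of_nonneg_right hbirth (X.integral_transProb_nonneg ht i n)]

theorem transProb_le_one {t : ℝ} (ht : 0 ≤ t) (i j : ℕ) : X.transProb t i j ≤ 1 :=
  le_hasSum (X.hasSum_transProb ht i) j fun k _ => X.transProb_nonneg ht i k

end Semigroup

end BirthDeath

/-- Detailed balance of the weights `α` for birth rates `b` and death rates `s`: the flow from `n`
to `n + 1` equals the flow back. -/
def DetailedBalance (b s α : ℕ → ℝ) : Prop := ∀ n, b n * α n = s (n + 1) * α (n + 1)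

theorem DetailedBalance.mul_eq_mul {b s α : ℕ → ℝ} (hα : DetailedBalance b s α)
    (hb : ∀ n, 0 < b n) (hpos : ∀ n, 0 < α n) {x : ℕ → ℝ} (hx : DetailedBalance b s x) (n : ℕ) :
    x n * α 0 = x 0 * α n := by
  induction n with
  | zero => rfl
  | succ n ih =>
    have hs : s (n + 1) ≠ 0 := fun h => by
      have := hα n
      rw [h, zero_mul] at this
      exact (mul_pos (hb n) (hpos n)).ne' this
    refine mul_left_cancel₀ hs ?_
    linear_combination b n * ih - α 0 * hx n + x 0 * hα n

namespace BirthDeath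

variable {X : BirthDeath}

/-- A stationary distribution. For a birth-death process stationarity is detailed balance. -/
structure IsStationary (X : BirthDeath) (α : ℕ → ℝ) : Prop where
  nonneg : ∀ n, 0 ≤ α n
  balance : DetailedBalance X.birth X.death α
  hasSum_one : HasSum α 1

namespace IsStationary

variable {α : ℕ → ℝ} (hα : X.IsStationary α)
include hα

theorem norm_mul_le (g : ℕ →ᵇ ℝ) (n : ℕ) : ‖α n * g n‖ ≤ α n * ‖g‖ := by
  rw [norm_mul, Real.norm_of_nonneg (hα.nonneg n)]
  exact mul_le_mul_of_nonneg_left (g.norm_coe_le_norm n) (hα.nonneg n)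

theorem summable_mul (g : ℕ →ᵇ ℝ) : Summable fun n => α n * g n :=
  (hα.hasSum_one.summable.mul_right ‖g‖).of_norm_bounded (hα.norm_mul_le g)

-- By detailed balance the sum telescopes.
theorem tsum_mul_generator_apply (g : ℕ →ᵇ ℝ) : ∑' n, α n * X.generator g n = 0 := by
  set flow : ℕ → ℝ := fun n => X.death n * (α n * (g n - g (n - 1))) with hflow
  have hstep : ∀ n, α n * X.generator g n = flow (n + 1) - flow n := fun n => by
    simp only [hflow, generator_apply, Nat.add_sub_cancel]
    linear_combination (g (n + 1) - g n) * hα.balance n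
  have hbound : ∀ n, ‖flow n‖ ≤ X.rate * (α n * (‖g‖ + ‖g‖)) := fun n => by
    have hrate : X.death n ≤ X.rate := by
      linarith [X.birth_nonneg n, X.birth_add_death_le n]
    have hdiff : ‖g n - g (n - 1)‖ ≤ ‖g‖ + ‖g‖ :=
      (norm_sub_le _ _).trans (add_le_add (g.norm_coe_le_norm _) (g.norm_coe_le_norm _))
    rw [hflow, norm_mul, norm_mul, Real.norm_of_nonneg (X.death_nonneg n),
      Real.norm_of_nonneg (hα.nonneg n)]
    exact mul_le_mul hrate (mul_le_mul_of_nonneg_left hdiff (hα.nonneg n))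
      (mul_nonneg (hα.nonneg n) (norm_nonneg _)) X.rate_nonneg
  have hlim : Tendsto flow atTop (𝓝 0) := by
    refine squeeze_zero_norm hbound ?_
    simpa using (hα.hasSum_one.summable.tendsto_atTop_zero.mul_const (‖g‖ + ‖g‖)).const_mul X.rate
  refine tendsto_nhds_unique (hα.summable_mul (X.generator g)).hasSum.tendsto_sum_nat ?_
  simpa only [hstep, Finset.sum_range_sub, show flow 0 = 0 by simp [hflow], sub_zero] using hlim

/-- The mean under a stationary distribution, as a functional on the bounded functions. -/
noncomputable def mean : (ℕ →ᵇ ℝ) →L[ℝ] ℝ :=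
  LinearMap.mkContinuous
    { toFun := fun g => ∑' n, α n * g n
      map_add' := fun f g => by
        simp only [BoundedContinuousFunction.add_apply, mul_add]
        exact (hα.summable_mul f).tsum_add (hα.summable_mul g)
      map_smul' := fun r g => by
        simp only [BoundedContinuousFunction.smul_apply, smul_eq_mul, mul_left_comm _ r,
          tsum_mul_left, RingHom.id_apply] }
    1 fun g => by
      rw [one_mul]
      exact tsum_of_norm_bounded (f := fun n => α n * g n)
        (by simpa using hα.hasSum_one.mul_right ‖g‖) (hα.norm_mul_le g)

theorem tsum_mul_semigroup_apply (g : ℕ →ᵇ ℝ) (t : ℝ) :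
    ∑' n, α n * X.semigroup t g n = ∑' n, α n * g n :=
  map_expSemigroup_eq (A := X.generator) (φ := hα.mean)
    (fun r => by rw [pow_succ']; exact hα.tsum_mul_generator_apply _) t

theorem mul_transProb_le {t : ℝ} (ht : 0 ≤ t) (i j : ℕ) : α i * X.transProb t i j ≤ α j := by
  have h : ∑' n, α n * X.transProb t n j = α j := by
    refine (hα.tsum_mul_semigroup_apply (ind {j}) t).trans ?_
    rw [tsum_eq_single j fun n hn => by simp [ind_apply, hn]]
    simp [ind_apply]
  rw [← h]
  exact (hα.summable_mul (X.semigroup t (ind {j}))).le_tsum i fun n _ =>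
    mul_nonneg (hα.nonneg n) (X.transProb_nonneg ht n j)

end IsStationary

section Occupation

variable (X)

/-- The expected fraction of the time until `T` that is spent in state `n`, starting in `i`. -/
noncomputable def occupation (i : ℕ) (T : ℝ) (n : ℕ) : ℝ :=
  1 / T * ∫ t in (0 : ℝ)..T, X.transProb t i n

theorem occupation_nonneg {T : ℝ} (hT : 0 < T) (i n : ℕ) : 0 ≤ X.occupation i T n :=
  mul_nonneg (by positivity) (X.integral_transProb_nonneg hT.le i n)

theorem occupation_le {T : ℝ} (hT : 0 < T) {i n : ℕ} {C : ℝ}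
    (hC : ∀ t, 0 ≤ t → X.transProb t i n ≤ C) : X.occupation i T n ≤ C := by
  have h : ∫ t in (0 : ℝ)..T, X.transProb t i n ≤ ∫ _ in (0 : ℝ)..T, C :=
    intervalIntegral.integral_mono_on hT.le (X.intervalIntegrable_transProb i n 0 T)
      (continuous_const.intervalIntegrable _ _) fun t ht => hC t ht.1
  rw [intervalIntegral.integral_const, smul_eq_mul, sub_zero] at h
  rwa [occupation, one_div, inv_mul_le_iff₀ hT]

theorem tendsto_occupation_balance (i n : ℕ) :
    Tendsto (fun T => X.death (n + 1) * X.occupation i T (n + 1) - X.birth n * X.occupation i T n)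
      atTop (𝓝 0) := by
  refine squeeze_zero_norm' ?_ tendsto_inv_atTop_zero
  filter_upwards [eventually_gt_atTop 0] with T hT
  have hdiff : X.death (n + 1) * X.occupation i T (n + 1) - X.birth n * X.occupation i T n
      = T⁻¹ * (∑ j ∈ Finset.range (n + 1), X.transProb T i j
        - ∑ j ∈ Finset.range (n + 1), X.transProb 0 i j) := by
    rw [sum_transProb_sub_eq_integral, occupation, occupation]
    ring
  rw [hdiff, norm_mul, Real.norm_of_nonneg (by positivity)]
  refine mul_le_of_le_one_right (by positivity) (abs_sub_le_iff.2 ⟨?_, ?_⟩)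
  · linarith [X.sum_transProb_le_one hT.le i (n + 1), X.sum_transProb_nonneg le_rfl i (n + 1)]
  · linarith [X.sum_transProb_le_one le_rfl i (n + 1), X.sum_transProb_nonneg hT.le i (n + 1)]

theorem exists_tendsto_occupation (i : ℕ) {U : Ultrafilter ℝ} (hU : (U : Filter ℝ) ≤ atTop) :
    ∃ x : ℕ → ℝ, ∀ n, Tendsto (fun T => X.occupation i T n) U (𝓝 (x n)) := by
  suffices ∀ n, ∃ x, Tendsto (fun T => X.occupation i T n) U (𝓝 x) from Classical.skolem.1 this
  intro n
  have hmem : ∀ᶠ T in (U : Filter ℝ), X.occupation i T n ∈ Set.Icc (0 : ℝ) 1 := by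
    filter_upwards [hU (eventually_gt_atTop 0)] with T hT
    exact ⟨X.occupation_nonneg hT i n, X.occupation_le hT fun t ht => X.transProb_le_one ht i n⟩
  obtain ⟨x, -, hx⟩ := isCompact_Icc.ultrafilter_le_nhds
    (U.map fun T => X.occupation i T n) (le_principal_iff.2 hmem)
  exact ⟨x, hx⟩

variable {X} {l : Filter ℝ} [l.NeBot] (hl : l ≤ atTop) {i : ℕ} {x : ℕ → ℝ}
  (hx : ∀ n, Tendsto (fun T => X.occupation i T n) l (𝓝 (x n)))
include hl hx

theorem nonneg_of_tendsto_occupation (n : ℕ) : 0 ≤ x n :=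
  ge_of_tendsto (hx n) (hl ((eventually_gt_atTop 0).mono fun _ hT => X.occupation_nonneg hT i n))

theorem detailedBalance_of_tendsto_occupation : DetailedBalance X.birth X.death x := fun n => by
  have h := tendsto_nhds_unique (((hx (n + 1)).const_mul _).sub ((hx n).const_mul _))
    ((X.tendsto_occupation_balance i n).mono_left hl)
  linarith

end Occupation

/-- The long-run time average of the expectation of `f`, for the process started in `i`, exists and
equals `a`; all the expectations and integrals involved are finite. -/
structure HasTimeAverage (X : BirthDeath) (f : ℕ → ℝ) (i : ℕ) (a : ℝ) : Prop where
  summable : ∀ t : ℝ, 0 ≤ t → Summable fun j => X.transProb t i j * f j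
  intervalIntegrable : ∀ T : ℝ, 0 ≤ T →
    IntervalIntegrable (fun t => ∑' j, X.transProb t i j * f j) MeasureTheory.volume 0 T
  tendsto : Tendsto (fun T : ℝ => 1 / T * ∫ t in (0 : ℝ)..T, ∑' j, X.transProb t i j * f j)
    atTop (𝓝 a)

theorem hasTimeAverage_const (X : BirthDeath) (R : ℝ) (i : ℕ) :
    X.HasTimeAverage (fun _ => R) i R where
  summable t ht := (X.hasSum_transProb ht i).summable.mul_right R
  intervalIntegrable T hT := by
    refine (intervalIntegrable_congr (f := fun _ => R) fun t ht => ?_).1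
      (continuous_const.intervalIntegrable _ _)
    rw [Set.uIoc_of_le hT] at ht
    rw [((X.hasSum_transProb ht.1.le i).mul_right R).tsum_eq, one_mul]
  tendsto := by
    refine tendsto_const_nhds.congr' ?_
    filter_upwards [eventually_gt_atTop 0] with T hT
    have h : ∫ t in (0 : ℝ)..T, ∑' j, X.transProb t i j * R = ∫ _ in (0 : ℝ)..T, R :=
      intervalIntegral.integral_congr fun t ht => by
        rw [Set.uIcc_of_le hT.le] at ht
        exact ((X.hasSum_transProb ht.1 i).mul_right R).tsum_eq.trans (one_mul R)
    rw [h, intervalIntegral.integral_const, smul_eq_mul, sub_zero]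
    field_simp

namespace HasTimeAverage

theorem sub {f f' : ℕ → ℝ} {i : ℕ} {a a' : ℝ} (h : X.HasTimeAverage f i a)
    (h' : X.HasTimeAverage f' i a') : X.HasTimeAverage (fun j => f j - f' j) i (a - a') := by
  have htsum : ∀ t : ℝ, 0 ≤ t → ∑' j, X.transProb t i j * (f j - f' j)
      = ∑' j, X.transProb t i j * f j - ∑' j, X.transProb t i j * f' j := fun t ht => by
    simp only [mul_sub]
    exact (h.summable t ht).tsum_sub (h'.summable t ht)
  refine ⟨fun t ht => ?_, fun T hT => ?_, ?_⟩
  · simpa only [mul_sub] using (h.summable t ht).sub (h'.summable t ht)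
  · refine (intervalIntegrable_congr fun t ht => ?_).1
      ((h.intervalIntegrable T hT).sub (h'.intervalIntegrable T hT))
    rw [Set.uIoc_of_le hT] at ht
    exact (htsum t ht.1.le).symm
  · refine (h.tendsto.sub h'.tendsto).congr' ?_
    filter_upwards [eventually_ge_atTop 0] with T hT
    rw [← mul_sub, ← intervalIntegral.integral_sub (h.intervalIntegrable T hT)
      (h'.intervalIntegrable T hT)]
    congr 1
    refine intervalIntegral.integral_congr fun t ht => ?_
    rw [Set.uIcc_of_le hT] at ht
    exact (htsum t ht.1).symm

theorem sum_mul_le {l : Filter ℝ} [l.NeBot] (hl : l ≤ atTop) {i : ℕ} {x : ℕ → ℝ}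
    (hx : ∀ n, Tendsto (fun T => X.occupation i T n) l (𝓝 (x n))) {f : ℕ → ℝ} {a : ℝ}
    (h : X.HasTimeAverage f i a) {n : ℕ} (hf : ∀ j, n ≤ j → 0 ≤ f j) :
    ∑ j ∈ Finset.range n, x j * f j ≤ a := by
  refine le_of_tendsto_of_tendsto (tendsto_finsetSum _ fun j _ => (hx j).mul_const (f j))
    (h.tendsto.mono_left hl) ?_
  filter_upwards [hl (eventually_gt_atTop 0)] with T hT
  have hint : ∀ j, IntervalIntegrable (fun t => X.transProb t i j * f j)
      MeasureTheory.volume 0 T := fun j => (X.intervalIntegrable_transProb i j 0 T).mul_const (f j)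
  calc ∑ j ∈ Finset.range n, X.occupation i T j * f j
      = 1 / T * ∫ t in (0 : ℝ)..T, ∑ j ∈ Finset.range n, X.transProb t i j * f j := by
        rw [intervalIntegral.integral_finsetSum fun j _ => hint j, Finset.mul_sum]
        simp only [occupation, intervalIntegral.integral_mul_const, mul_assoc]
    _ ≤ 1 / T * ∫ t in (0 : ℝ)..T, ∑' j, X.transProb t i j * f j := by
        refine mul_le_mul_of_nonneg_left (intervalIntegral.integral_mono_on hT.le
          ((continuous_finsetSum _ fun j _ =>
            (X.continuous_transProb i j).mul_const (f j)).intervalIntegrable _ _)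
          (h.intervalIntegrable T hT.le) fun t ht => ?_) (by positivity)
        exact (h.summable t ht.1).sum_le_tsum _ fun j hj =>
          mul_nonneg (X.transProb_nonneg ht.1 i j) (hf j (by simpa using hj))

end HasTimeAverage

-- Take the limit of the occupation times along an ultrafilter; since `f → ∞`, no mass escapes.
theorem HasTimeAverage.exists_isStationary {f : ℕ → ℝ} (hf : Tendsto f atTop atTop) {i : ℕ} {a : ℝ}
    (h : X.HasTimeAverage f i a) :
    ∃ α, X.IsStationary α ∧ Summable (fun n => α n * f n) ∧ ∑' n, α n * f n ≤ a := by
  have hU : (Ultrafilter.of (atTop : Filter ℝ) : Filter ℝ) ≤ atTop := Ultrafilter.of_le _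
  obtain ⟨α, hα⟩ := X.exists_tendsto_occupation i hU
  have hnonneg := nonneg_of_tendsto_occupation hU hα
  have hle_one : ∀ n, ∑ j ∈ Finset.range n, α j ≤ 1 := fun n => by
    simpa using (hasTimeAverage_const X 1 i).sum_mul_le hU hα (n := n) fun _ _ => zero_le_one
  have hsummable : Summable α := summable_of_sum_range_le hnonneg hle_one
  have hpartial : ∀ R n, (∀ j, n ≤ j → R ≤ f j) → ∑ j ∈ Finset.range n, α j * (f j - R) ≤ a - R :=
    fun R n hR => (h.sub (hasTimeAverage_const X R i)).sum_mul_le hU hα fun j hj =>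
      sub_nonneg.2 (hR j hj)
  have hf_summable : Summable fun n => α n * f n := by
    obtain ⟨L, hL⟩ := bddBelow_range_of_tendsto_atTop_atTop hf
    replace hL : ∀ n, L ≤ f n := fun n => hL ⟨n, rfl⟩
    have hshift : Summable fun n => α n * (f n - L) :=
      summable_of_sum_range_le (fun n => mul_nonneg (hnonneg n) (sub_nonneg.2 (hL n)))
        fun n => hpartial L n fun j _ => hL j
    exact (hshift.add (hsummable.mul_right L)).congr fun n => by ring
  have htsum_le : ∀ R, ∑' n, α n * f n - (∑' n, α n) * R ≤ a - R := fun R => by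
    refine le_of_tendsto
      (hf_summable.hasSum.sub (hsummable.hasSum.mul_right R)).tendsto_sum_nat ?_
    obtain ⟨N, hN⟩ := eventually_atTop.1 (hf.eventually_ge_atTop R)
    filter_upwards [eventually_ge_atTop N] with n hn
    simpa only [mul_sub] using hpartial R n fun j hj => hN j (hn.trans hj)
  have hone : ∑' n, α n = 1 := by
    refine (hsummable.tsum_le_of_sum_range_le hle_one).antisymm (not_lt.1 fun hlt => ?_)
    have hpos : 0 < 1 - ∑' n, α n := sub_pos.2 hlt
    have := htsum_le ((a - ∑' n, α n * f n + 1) / (1 - ∑' n, α n))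
    have := div_mul_cancel₀ (a - ∑' n, α n * f n + 1) hpos.ne'
    linarith
  exact ⟨α, ⟨hnonneg, detailedBalance_of_tendsto_occupation hU hα, hone ▸ hsummable.hasSum⟩,
    hf_summable, by simpa using htsum_le 0⟩

namespace IsStationary

variable {α : ℕ → ℝ} (hα : X.IsStationary α)
include hα

section Domination

variable {i : ℕ} (hi : 0 < α i)
include hi

theorem transProb_le_div {t : ℝ} (ht : 0 ≤ t) (j : ℕ) : X.transProb t i j ≤ α j / α i := by
  rw [le_div_iff₀ hi, mul_comm]
  exact hα.mul_transProb_le ht i j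

theorem norm_transProb_mul_le (f : ℕ → ℝ) {t : ℝ} (ht : 0 ≤ t) (j : ℕ) :
    ‖X.transProb t i j * f j‖ ≤ ‖α j * f j‖ / α i := by
  rw [norm_mul, norm_mul, Real.norm_of_nonneg (X.transProb_nonneg ht i j),
    Real.norm_of_nonneg (hα.nonneg j), mul_div_right_comm]
  exact mul_le_mul_of_nonneg_right (hα.transProb_le_div hi ht j) (norm_nonneg _)

theorem norm_occupation_mul_le (f : ℕ → ℝ) {T : ℝ} (hT : 0 < T) (j : ℕ) :
    ‖X.occupation i T j * f j‖ ≤ ‖α j * f j‖ / α i := by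
  rw [norm_mul, norm_mul, Real.norm_of_nonneg (X.occupation_nonneg hT i j),
    Real.norm_of_nonneg (hα.nonneg j), mul_div_right_comm]
  exact mul_le_mul_of_nonneg_right
    (X.occupation_le hT fun t ht => hα.transProb_le_div hi ht j) (norm_nonneg _)

variable {f : ℕ → ℝ} (hf : Summable fun n => α n * f n)
include hf

theorem summable_transProb_mul {t : ℝ} (ht : 0 ≤ t) : Summable fun j => X.transProb t i j * f j :=
  (hf.norm.div_const (α i)).of_norm_bounded (hα.norm_transProb_mul_le hi f ht)

theorem intervalIntegrable_tsum_transProb_mul {T : ℝ} (hT : 0 ≤ T) :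
    IntervalIntegrable (fun t => ∑' j, X.transProb t i j * f j) MeasureTheory.volume 0 T := by
  have hcont : ContinuousOn (fun t => ∑' j, X.transProb t i j * f j) (Set.Ici 0) :=
    continuousOn_tsum (fun j => ((X.continuous_transProb i j).mul_const _).continuousOn)
      (hf.norm.div_const (α i)) fun j _ ht => hα.norm_transProb_mul_le hi f ht j
  refine (hcont.mono ?_).intervalIntegrable
  rw [Set.uIcc_of_le hT]
  exact Set.Icc_subset_Ici_self

theorem tsum_occupation_mul {T : ℝ} (hT : 0 < T) :
    ∑' j, X.occupation i T j * f j = 1 / T * ∫ t in (0 : ℝ)..T, ∑' j, X.transProb t i j * f j := by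
  have hmem : ∀ t ∈ Set.uIoc 0 T, 0 ≤ t := fun t ht => by
    rw [Set.uIoc_of_le hT.le] at ht
    exact ht.1.le
  have h := intervalIntegral.hasSum_integral_of_dominated_convergence
    (μ := MeasureTheory.volume) (a := 0) (b := T) (F := fun j t => X.transProb t i j * f j)
    (fun j _ => ‖α j * f j‖ / α i)
    (fun j => ((X.continuous_transProb i j).mul_const _).aestronglyMeasurable)
    (fun j => Eventually.of_forall fun t ht => hα.norm_transProb_mul_le hi f (hmem t ht) j)
    (Eventually.of_forall fun _ _ => hf.norm.div_const (α i))
    (continuous_const.intervalIntegrable _ _)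
    (Eventually.of_forall fun t ht => (hα.summable_transProb_mul hi hf (hmem t ht)).hasSum)
  rw [← h.tsum_eq, ← tsum_mul_left]
  simp only [occupation, intervalIntegral.integral_mul_const, mul_assoc]

theorem tendsto_tsum_occupation_mul {l : Filter ℝ} (hl : l ≤ atTop) {x : ℕ → ℝ}
    (hx : ∀ n, Tendsto (fun T => X.occupation i T n) l (𝓝 (x n))) :
    Tendsto (fun T => 1 / T * ∫ t in (0 : ℝ)..T, ∑' j, X.transProb t i j * f j) l
      (𝓝 (∑' j, x j * f j)) := by
  refine (tendsto_tsum_of_dominated_convergence (hf.norm.div_const (α i))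
    (fun j => (hx j).mul_const (f j)) ?_).congr' ?_
  · filter_upwards [hl (eventually_gt_atTop 0)] with T hT j
    exact hα.norm_occupation_mul_le hi f hT j
  · filter_upwards [hl (eventually_gt_atTop 0)] with T hT
    exact hα.tsum_occupation_mul hi hf hT

end Domination

variable (hbirth : ∀ n, 0 < X.birth n) (hpos : ∀ n, 0 < α n)
include hbirth hpos

-- Every limit point of the occupation times is in detailed balance, hence proportional to `α`, and
-- by domination it is again a probability distribution.
theorem tendsto_occupation (i j : ℕ) :
    Tendsto (fun T => X.occupation i T j) atTop (𝓝 (α j)) := by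
  refine tendsto_iff_ultrafilter _ _ _ |>.2 fun U hU => ?_
  obtain ⟨x, hx⟩ := X.exists_tendsto_occupation i hU
  have hprop := hα.balance.mul_eq_mul hbirth hpos (detailedBalance_of_tendsto_occupation hU hx)
  have hsum : ∑' n, x n = 1 := by
    have hone : Summable fun n => α n * (1 : ℝ) := by simpa using hα.hasSum_one.summable
    have h := tendsto_nhds_unique (hα.tendsto_tsum_occupation_mul (hpos i) hone hU hx)
      ((hasTimeAverage_const X 1 i).tendsto.mono_left hU)
    simpa using h
  have hzero : α 0 = x 0 := by
    have h := congrArg (fun y : ℕ → ℝ => ∑' n, y n) (funext hprop)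
    simpa [tsum_mul_left, tsum_mul_right, hsum, hα.hasSum_one.tsum_eq] using h
  have hxj : x j = α j := mul_right_cancel₀ (hpos 0).ne' (by rw [hprop, hzero, mul_comm])
  exact hxj ▸ hx j

theorem hasTimeAverage {f : ℕ → ℝ} (hf : Summable fun n => α n * f n) (i : ℕ) :
    X.HasTimeAverage f i (∑' n, α n * f n) where
  summable _ ht := hα.summable_transProb_mul (hpos i) hf ht
  intervalIntegrable _ hT := hα.intervalIntegrable_tsum_transProb_mul (hpos i) hf hT
  tendsto := hα.tendsto_tsum_occupation_mul (hpos i) hf le_rfl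
    (hα.tendsto_occupation hbirth hpos i)

end IsStationary

end BirthDeath

theorem hasSum_ite_lt {y : ℕ → ℝ} {Y : ℝ} (hy : HasSum y Y) (x : ℕ → ℝ) (m : ℕ) :
    HasSum (fun n => if n < m then x n else y n) (Y + ∑ n ∈ Finset.range m, (x n - y n)) := by
  have hhead : HasSum (fun n => if n < m then x n - y n else 0)
      (∑ n ∈ Finset.range m, (x n - y n)) := by
    have h : HasSum (fun n => if n < m then x n - y n else 0) _ :=
      hasSum_sum_of_ne_finset_zero (s := Finset.range m) fun n hn => if_neg (by simpa using hn)
    rwa [Finset.sum_congr rfl fun n hn => if_pos (Finset.mem_range.1 hn)] at h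
  refine (hy.add hhead).congr_fun fun n => ?_
  split_ifs <;> ring

theorem hasSum_mul_update_of_scaled_tail {α β w : ℕ → ℝ} {m : ℕ} {ρ : ℝ}
    (hlt : ∀ n < m, β n = α n) (hge : ∀ n, m ≤ n → β n = ρ * α n)
    (hw : HasSum (fun n => α n * w n) 0) (v : ℝ) :
    HasSum (fun n => β n * Function.update w m v n)
      ((1 - ρ) * ∑ n ∈ Finset.range m, α n * w n + ρ * α m * (v - w m)) := by
  have hupdate : ∑ n ∈ Finset.range m,
        Function.update (fun n => ρ * (α n * w n)) m (ρ * (α m * v)) n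
      = ρ * ∑ n ∈ Finset.range m, α n * w n := by
    rw [Finset.mul_sum]
    exact Finset.sum_congr rfl fun n hn => Function.update_of_ne (Finset.mem_range.1 hn).ne ..
  have h := hasSum_ite_lt ((hw.mul_left ρ).update m (ρ * (α m * v))) (fun n => α n * w n) m
  rw [Finset.sum_sub_distrib, hupdate] at h
  convert h.congr_fun fun n => ?_ using 1
  · ring
  · rcases lt_trichotomy n m with h | rfl | h
    · rw [if_pos h, hlt n h, Function.update_of_ne h.ne]
    · rw [if_neg (lt_irrefl _), hge _ le_rfl, Function.update_self, Function.update_self, mul_assoc]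
    · rw [if_neg h.not_gt, hge n h.le, Function.update_of_ne h.ne', Function.update_of_ne h.ne',
        mul_assoc]

/-- The birth-death chain with birth rates `b` and death rates `s` is positive recurrent and `w`
has negative mean in its steady state. The reversible measure `β` is not normalized, so that it can
be compared with that of a chain which differs from this one in finitely many states only. -/
def HasNegativeMean (b s w : ℕ → ℝ) : Prop :=
  ∃ β : ℕ → ℝ, (∀ n, 0 < β n) ∧ DetailedBalance b s β ∧ Summable β ∧
    ∃ W < 0, HasSum (fun n => β n * w n) W

namespace DetailedBalance

variable {b s s' α w w' : ℕ → ℝ} {m : ℕ}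

theorem pos_of_le (hα : DetailedBalance b s α) (hb : ∀ n, 0 < b n) (hnonneg : ∀ n, 0 ≤ α n)
    (hm : 0 < α m) {n : ℕ} (hn : m ≤ n) : 0 < α n := by
  induction n, hn using Nat.le_induction with
  | base => exact hm
  | succ n _ ih =>
    refine (hnonneg (n + 1)).lt_of_ne fun h => (mul_pos (hb n) ih).ne' ?_
    rw [hα n, ← h, mul_zero]

theorem hasSum_death_mul (hα : DetailedBalance b s α) (hs : s 0 = 0) {F : ℝ}
    (hF : HasSum (fun n => b n * α n) F) : HasSum (fun n => s n * α n) F := by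
  refine (hasSum_nat_add_iff' 1).1 ?_
  simpa [hs] using hF.congr_fun fun n => (hα n).symm

theorem exists_extension (hb : ∀ n, 0 < b n) (hs : ∀ n < m, 0 < s (n + 1))
    (hpos : ∀ n, m ≤ n → 0 < α n) (hα : ∀ n, m ≤ n → b n * α n = s (n + 1) * α (n + 1)) :
    ∃ β : ℕ → ℝ, (∀ n, m ≤ n → β n = α n) ∧ (∀ n, 0 < β n) ∧ DetailedBalance b s β := by
  induction m generalizing α with
  | zero => exact ⟨α, fun _ _ => rfl, fun n => hpos n n.zero_le, fun n => hα n n.zero_le⟩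
  | succ m ih =>
    set α' := Function.update α m (s (m + 1) * α (m + 1) / b m)
    have hα'm : α' m = s (m + 1) * α (m + 1) / b m := Function.update_self ..
    have hα' : ∀ n, m + 1 ≤ n → α' n = α n := fun n hn => Function.update_of_ne (by omega) ..
    obtain ⟨β, hβ, hβpos, hbal⟩ := ih (α := α') (fun n hn => hs n (by omega))
      (fun n hn => by
        rcases hn.eq_or_lt with rfl | hn
        · rw [hα'm]
          exact div_pos (mul_pos (hs m m.lt_succ_self) (hpos _ le_rfl)) (hb m)
        · rw [hα' n hn]
          exact hpos n hn)
      (fun n hn => by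
        rw [hα' (n + 1) (by omega)]
        rcases hn.eq_or_lt with rfl | hn
        · rw [hα'm, mul_div_cancel₀ _ (hb m).ne']
        · rw [hα' n hn, hα n hn])
    exact ⟨β, fun n hn => (hβ n (by omega)).trans (hα' n hn), hβpos, hbal⟩

-- Keep `α` from `m` on and extend it below `m` by detailed balance for the new rates: this replaces
-- the nonnegative head of the sum by a negative one.
theorem hasNegativeMean_of_head_nonneg (hα : DetailedBalance b s α) (hb : ∀ n, 0 < b n)
    (hnonneg : ∀ n, 0 ≤ α n) (hsum : Summable α) (hw : HasSum (fun n => α n * w n) 0)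
    (h0m : 0 < m) (hm : 0 < α m) (hhead : 0 ≤ ∑ n ∈ Finset.range m, α n * w n)
    (hs' : ∀ n < m, 0 < s' (n + 1)) (hss' : ∀ n, m < n → s' n = s n)
    (hneg : ∀ n < m, w' n < 0) (hwm : w' m ≤ w m) (hww' : ∀ n, m < n → w' n = w n) :
    HasNegativeMean b s' w' := by
  obtain ⟨β, hβ, hβpos, hβbal⟩ := exists_extension (α := α) hb hs'
    (fun n hn => hα.pos_of_le hb hnonneg hm hn)
    fun n hn => by rw [hss' (n + 1) (Nat.lt_succ_of_le hn), hα n]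
  have hβsum : Summable β :=
    ((hasSum_ite_lt hsum.hasSum β m).congr_fun fun n => by
      split_ifs with h
      · rfl
      · exact hβ n (not_lt.1 h)).summable
  have hβw := hasSum_ite_lt (hw.update m (α m * w' m)) (fun n => β n * w' n) m
  refine ⟨β, hβpos, hβbal, hβsum, _, ?_, hβw.congr_fun fun n => ?_⟩
  · have hupdate : ∑ n ∈ Finset.range m,
          Function.update (fun n => α n * w n) m (α m * w' m) n
        = ∑ n ∈ Finset.range m, α n * w n :=
      Finset.sum_congr rfl fun n hn => Function.update_of_ne (Finset.mem_range.1 hn).ne ..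
    have hβneg : ∑ n ∈ Finset.range m, β n * w' n < 0 :=
      Finset.sum_neg (fun n hn => mul_neg_of_pos_of_neg (hβpos n) (hneg n (Finset.mem_range.1 hn)))
        (Finset.nonempty_range_iff.2 h0m.ne')
    have hm' : α m * w' m ≤ α m * w m := mul_le_mul_of_nonneg_left hwm hm.le
    rw [Finset.sum_sub_distrib, hupdate]
    linarith
  · rcases lt_trichotomy n m with h | rfl | h
    · rw [if_pos h]
    · rw [if_neg (lt_irrefl n), Function.update_self, hβ n le_rfl]
    · rw [if_neg h.not_gt, Function.update_of_ne h.ne', hβ n h.le, hww' n h]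

theorem speed_up (hα : DetailedBalance b s α) {β : ℕ → ℝ} {p : ℕ} {ρ σ : ℝ}
    (hσ : σ * ρ = s (p + 1)) (hlt : ∀ n < p + 1, β n = α n) (hge : ∀ n, p + 1 ≤ n → β n = ρ * α n) :
    DetailedBalance b (Function.update s (p + 1) σ) β := fun n => by
  have h := hα n
  rcases lt_trichotomy n p with hn | rfl | hn
  · rwa [hlt n (by omega), hlt (n + 1) (by omega), Function.update_of_ne (by omega)]
  · rwa [hlt n (by omega), hge (n + 1) le_rfl, Function.update_self, ← mul_assoc, hσ]
  · rw [hge n (by omega), hge (n + 1) (by omega), Function.update_of_ne (by omega)]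
    linear_combination ρ * h

-- Scaling `α` by `s m / σ ≤ 1` from `m` on gives detailed balance for the new rates. The head of
-- the sum is negative, so the tail is positive, and shrinking it leaves a negative sum.
theorem hasNegativeMean_update (hα : DetailedBalance b s α) (hb : ∀ n, 0 < b n)
    (hpos : ∀ n, 0 < α n) (hsum : Summable α) (hw : HasSum (fun n => α n * w n) 0)
    (hhead : ∑ n ∈ Finset.range m, α n * w n < 0) {σ v : ℝ} (hσ : s m ≤ σ) (hv : v ≤ w m)
    (hlt : s m < σ ∨ v < w m) :
    HasNegativeMean b (Function.update s m σ) (Function.update w m v) := by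
  obtain ⟨p, rfl⟩ : ∃ p, m = p + 1 :=
    Nat.exists_eq_succ_of_ne_zero (by rintro rfl; simp at hhead)
  have hsm : 0 < s (p + 1) :=
    pos_of_mul_pos_left (hα p ▸ mul_pos (hb p) (hpos p)) (hpos (p + 1)).le
  have hσ0 : 0 < σ := hsm.trans_le hσ
  set ρ := s (p + 1) / σ
  have hρ : 0 < ρ := div_pos hsm hσ0
  obtain ⟨β, hβ⟩ : ∃ β : ℕ → ℝ, ∀ n, β n = if n < p + 1 then α n else ρ * α n := ⟨_, fun _ => rfl⟩
  have hβlt : ∀ n < p + 1, β n = α n := fun n hn => (hβ n).trans (if_pos hn)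
  have hβge : ∀ n, p + 1 ≤ n → β n = ρ * α n := fun n hn => (hβ n).trans (if_neg hn.not_gt)
  refine ⟨β, fun n => ?_, hα.speed_up (mul_div_cancel₀ _ hσ0.ne') hβlt hβge,
    ((hasSum_ite_lt (hsum.mul_left ρ).hasSum α (p + 1)).congr_fun hβ).summable, _, ?_,
    hasSum_mul_update_of_scaled_tail hβlt hβge hw v⟩
  · rw [hβ]
    split_ifs
    exacts [hpos n, mul_pos hρ (hpos n)]
  · have hρα := mul_pos hρ (hpos (p + 1))
    rcases hlt with h | h
    · exact add_neg_of_neg_of_nonpos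
        (mul_neg_of_pos_of_neg (sub_pos.2 ((div_lt_one hσ0).2 h)) hhead)
        (mul_nonpos_of_nonneg_of_nonpos hρα.le (sub_nonpos.2 hv))
    · exact add_neg_of_nonpos_of_neg
        (mul_nonpos_of_nonneg_of_nonpos (sub_nonneg.2 ((div_le_one hσ0).2 hσ)) hhead.le)
        (mul_neg_of_pos_of_neg hρα (sub_neg.2 h))

end DetailedBalance

namespace GroupQueue

variable {K : ℕ} {Q : GroupQueue K} {d : Policy K}

/-- The assumptions under which policies can be compared by their steady states: all rates are
positive, and the holding cost increases to infinity. -/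
structure Regular (Q : GroupQueue K) : Prop where
  lam_pos : 0 < Q.lam
  mu_pos : ∀ k, 0 < Q.mu k
  h_mono : Monotone Q.h
  h_tendsto : Tendsto Q.h atTop atTop

theorem Standing.regular (hQ : Q.Standing) : Q.Regular :=
  ⟨hQ.lam_pos, hQ.mu_pos, hQ.h_mono, hQ.h_tendsto⟩

/-- The action `m` can be taken in state `n` by an efficient policy. -/
def IsFeasible (Q : GroupQueue K) (n : ℕ) (m : Fin K → ℕ) : Prop :=
  (∀ k, m k ≤ Q.M k) ∧ ∑ k, m k ≤ n

theorem isFeasible_add_single {n : ℕ} {v : Fin K → ℕ} {k : Fin K} (hv : ∀ j, v j ≤ Q.M j)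
    (hk : v k < Q.M k) (hsum : ∑ j, v j < n) : Q.IsFeasible n (v + Pi.single k 1) := by
  refine ⟨fun j => ?_, ?_⟩
  · rcases eq_or_ne j k with rfl | hj
    · simpa using hk
    · simpa [hj] using hv j
  · simpa [Finset.sum_add_distrib] using hsum

theorem isFeasible_single_min (k : Fin K) (n : ℕ) :
    Q.IsFeasible n (Pi.single k (min (Q.M k) n)) := by
  refine ⟨fun j => ?_, by simp⟩
  rcases eq_or_ne j k with rfl | hj
  · simp
  · simp [hj]

theorem update_mem_efficientPolicies (hd : d ∈ Q.efficientPolicies) {n : ℕ} {u : Fin K → ℕ}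
    (hu : Q.IsFeasible n u) : Function.update d n u ∈ Q.efficientPolicies := fun j => by
  rcases eq_or_ne j n with rfl | hj
  · rw [Function.update_self]
    exact hu
  · rw [Function.update_of_ne hj]
    exact hd j

theorem eq_zero_of_mem_efficientPolicies (hd : d ∈ Q.efficientPolicies) : d 0 = 0 :=
  funext fun k => Finset.sum_eq_zero_iff.1 (Nat.le_zero.1 (hd 0).2) k (Finset.mem_univ k)

theorem serviceRate_apply_zero (hd : d ∈ Q.efficientPolicies) : Q.serviceRate (d 0) = 0 := by
  simp [eq_zero_of_mem_efficientPolicies hd, serviceRate]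

theorem serviceRate_nonneg (hmu : ∀ k, 0 ≤ Q.mu k) (m : Fin K → ℕ) : 0 ≤ Q.serviceRate m :=
  Finset.sum_nonneg fun k _ => mul_nonneg (Nat.cast_nonneg _) (hmu k)

theorem serviceRate_mono (hmu : ∀ k, 0 ≤ Q.mu k) : Monotone Q.serviceRate := fun _ _ h =>
  Finset.sum_le_sum fun k _ => mul_le_mul_of_nonneg_right (Nat.cast_le.2 (h k)) (hmu k)

theorem sum_single_mul (k : Fin K) (b : ℕ) (x : Fin K → ℝ) :
    ∑ j, ((Pi.single k b : Fin K → ℕ) j : ℝ) * x j = b * x k := by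
  rw [Finset.sum_eq_single k (fun j _ hj => by simp [hj]) (by simp), Pi.single_eq_same]

theorem serviceRate_add (u v : Fin K → ℕ) :
    Q.serviceRate (u + v) = Q.serviceRate u + Q.serviceRate v := by
  simp only [serviceRate, Pi.add_apply, Nat.cast_add, add_mul, Finset.sum_add_distrib]

theorem serviceRate_single (k : Fin K) (b : ℕ) : Q.serviceRate (Pi.single k b) = b * Q.mu k :=
  sum_single_mul k b Q.mu

theorem tendsto_cost (hh : Tendsto Q.h atTop atTop) (hd : d ∈ Q.efficientPolicies) :
    Tendsto (fun n => Q.cost n (d n)) atTop atTop := by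
  refine tendsto_atTop_mono (fun n => ?_)
    (tendsto_atTop_add_const_right atTop (-∑ k, (Q.M k : ℝ) * |Q.c k|) hh)
  rw [cost, ← Finset.sum_neg_distrib]
  refine add_le_add_right (Finset.sum_le_sum fun k _ => ?_) _
  calc -((Q.M k : ℝ) * |Q.c k|) ≤ -((d n k : ℝ) * |Q.c k|) :=
        neg_le_neg (mul_le_mul_of_nonneg_right (Nat.cast_le.2 ((hd n).1 k)) (abs_nonneg _))
    _ = d n k * -|Q.c k| := (mul_neg _ _).symm
    _ ≤ d n k * Q.c k := mul_le_mul_of_nonneg_left (neg_abs_le _) (Nat.cast_nonneg _)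

section Chain

variable (hQ : Q.Regular) (hd : d ∈ Q.efficientPolicies)

/-- The number of customers under the policy `d`, as a birth-death process. -/
noncomputable def chain : BirthDeath where
  birth _ := Q.lam
  death n := Q.serviceRate (d n)
  rate := Q.lam + Q.serviceRate Q.M
  birth_nonneg _ := hQ.lam_pos.le
  death_nonneg n := serviceRate_nonneg (fun k => (hQ.mu_pos k).le) (d n)
  birth_add_death_le n :=
    add_le_add_right (serviceRate_mono (fun k => (hQ.mu_pos k).le) (hd n).1) _

theorem gen_pow_eq_generator_pow (r : ℕ) (g : ℕ →ᵇ ℝ) :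
    (Q.gen d ^ r) g = ((chain hQ hd).generator ^ r) g := by
  induction r with
  | zero => rfl
  | succ r ih =>
    rw [pow_succ', pow_succ', Module.End.mul_apply, ih]
    rfl

theorem transProb_eq (t : ℝ) (i j : ℕ) : Q.transProb d t i j = (chain hQ hd).transProb t i j := by
  have hind : (Pi.single j 1 : ℕ → ℝ) = BirthDeath.ind {j} := by
    ext n
    simp [BirthDeath.ind_apply, Pi.single_apply, Set.indicator_apply]
  refine (tsum_congr fun r => ?_).trans (hasSum_map_expSemigroup (chain hQ hd).generator
    (BoundedContinuousFunction.evalCLM ℝ i) (BirthDeath.ind {j}) t).tsum_eq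
  rw [hind, gen_pow_eq_generator_pow hQ hd]
  rfl

theorem hasAverageCost_iff {a : ℝ} :
    Q.HasAverageCost d a ↔
      ∀ i, (chain hQ hd).HasTimeAverage (fun n => Q.cost n (d n)) i a := by
  have hcost : ∀ i, Q.expCost d i =
      fun t => ∑' j, (chain hQ hd).transProb t i j * Q.cost j (d j) := fun i =>
    funext fun t => tsum_congr fun j => by rw [transProb_eq hQ hd]
  simp only [HasAverageCost, hcost, transProb_eq hQ hd]
  exact ⟨fun h i => ⟨(h i).1, (h i).2.1, (h i).2.2⟩,
    fun h i => ⟨(h i).summable, (h i).intervalIntegrable, (h i).tendsto⟩⟩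

end Chain

/-- `α` is a stationary distribution of the number of customers under `d`, in which the cost rate
has the mean `η`. -/
structure IsSteadyState (Q : GroupQueue K) (d : Policy K) (α : ℕ → ℝ) (η : ℝ) : Prop where
  nonneg : ∀ n, 0 ≤ α n
  balance : DetailedBalance (fun _ => Q.lam) (fun n => Q.serviceRate (d n)) α
  hasSum_one : HasSum α 1
  hasSum_cost : HasSum (fun n => α n * Q.cost n (d n)) η

theorem HasAverageCost.exists_isSteadyState {a : ℝ} (ha : Q.HasAverageCost d a) (hQ : Q.Regular)
    (hd : d ∈ Q.efficientPolicies) : ∃ α η, Q.IsSteadyState d α η ∧ η ≤ a := by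
  obtain ⟨α, hα, hcost, hle⟩ :=
    ((hasAverageCost_iff hQ hd).1 ha 0).exists_isStationary (tendsto_cost hQ.h_tendsto hd)
  exact ⟨α, _, ⟨hα.nonneg, hα.balance, hα.hasSum_one, hcost.hasSum⟩, hle⟩

theorem IsSteadyState.hasAverageCost {α : ℕ → ℝ} {η : ℝ} (hα : Q.IsSteadyState d α η)
    (hQ : Q.Regular) (hd : d ∈ Q.efficientPolicies) (hpos : ∀ n, 0 < α n) :
    Q.HasAverageCost d η := by
  have hst : (chain hQ hd).IsStationary α := ⟨hα.nonneg, hα.balance, hα.hasSum_one⟩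
  rw [hasAverageCost_iff hQ hd, ← hα.hasSum_cost.tsum_eq]
  exact hst.hasTimeAverage (fun _ => hQ.lam_pos) hpos hα.hasSum_cost.summable

/-- Group `k₀` has a server, no other group has a smaller ratio of cost to service rate or a larger
service rate, and no other group has both in common with it. -/
structure IsMostEfficient (Q : GroupQueue K) (k₀ : Fin K) : Prop where
  M_pos : 1 ≤ Q.M k₀
  ratio_le : ∀ k, Q.c k₀ / Q.mu k₀ ≤ Q.c k / Q.mu k
  mu_le : ∀ k, Q.mu k ≤ Q.mu k₀
  eq_of_eq : ∀ k, Q.mu k = Q.mu k₀ → Q.c k = Q.c k₀ → k = k₀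

theorem ScaleEconomies.isMostEfficient_zero [NeZero K] (hS : Q.ScaleEconomies) (hQ : Q.Standing) :
    Q.IsMostEfficient 0 where
  M_pos := hQ.M_pos 0
  ratio_le k := hS.ratio_mono (Fin.zero_le k)
  mu_le k := hS.mu_anti (Fin.zero_le k)
  eq_of_eq _ hmu hc := hQ.heterogeneous (Prod.ext hmu hc)

/-- The excess of the cost rate over `η`, when service in excess of the arrival rate is refunded at
the price `c k₀ / mu k₀` of group `k₀`. In the steady state of a policy with average cost `η` its
mean is zero, since the mean service rate is the arrival rate. -/
noncomputable def excessCost (Q : GroupQueue K) (k₀ : Fin K) (η : ℝ) (n : ℕ) (m : Fin K → ℕ) : ℝ :=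
  Q.cost n m - η - Q.c k₀ / Q.mu k₀ * (Q.serviceRate m - Q.lam)

section ExcessCost

variable {k₀ : Fin K} {η : ℝ}

theorem excessCost_add_single (n : ℕ) (v : Fin K → ℕ) (k : Fin K) :
    Q.excessCost k₀ η n (v + Pi.single k 1) =
      Q.excessCost k₀ η n v + (Q.c k - Q.c k₀ / Q.mu k₀ * Q.mu k) := by
  have hcost : Q.cost n (v + Pi.single k 1) = Q.cost n v + Q.c k := by
    simp only [cost, Pi.add_apply, Nat.cast_add, add_mul, Finset.sum_add_distrib, sum_single_mul,
      Nat.cast_one, one_mul, add_assoc]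
  rw [excessCost, excessCost, hcost, serviceRate_add, serviceRate_single, Nat.cast_one]
  ring

theorem excessCost_single_self (hmu : Q.mu k₀ ≠ 0) (n b : ℕ) :
    Q.excessCost k₀ η n (Pi.single k₀ b) = Q.h n - η + Q.c k₀ / Q.mu k₀ * Q.lam := by
  rw [excessCost, cost, sum_single_mul, serviceRate_single]
  field_simp
  ring

theorem IsMostEfficient.price_mul_le (h₀ : Q.IsMostEfficient k₀) (hmu : ∀ k, 0 < Q.mu k)
    (k : Fin K) : Q.c k₀ / Q.mu k₀ * Q.mu k ≤ Q.c k :=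
  (le_div_iff₀ (hmu k)).1 (h₀.ratio_le k)

theorem IsMostEfficient.le_excessCost (h₀ : Q.IsMostEfficient k₀) (hmu : ∀ k, 0 < Q.mu k) (n : ℕ)
    (m : Fin K → ℕ) : Q.h n - η + Q.c k₀ / Q.mu k₀ * Q.lam ≤ Q.excessCost k₀ η n m := by
  have h : Q.c k₀ / Q.mu k₀ * Q.serviceRate m ≤ ∑ k, (m k : ℝ) * Q.c k := by
    rw [serviceRate, Finset.mul_sum]
    refine Finset.sum_le_sum fun k _ => ?_
    rw [mul_left_comm]
    exact mul_le_mul_of_nonneg_left (h₀.price_mul_le hmu k) (Nat.cast_nonneg _)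
  rw [excessCost, cost]
  linarith

/-- In state `n`, the action `u` serves at least at the rate of `m` for at most its excess cost, and
one of the two inequalities is strict. -/
def IsBetterAction (Q : GroupQueue K) (k₀ : Fin K) (η : ℝ) (n : ℕ) (m u : Fin K → ℕ) : Prop :=
  Q.serviceRate m ≤ Q.serviceRate u ∧ Q.excessCost k₀ η n u ≤ Q.excessCost k₀ η n m ∧
    (Q.serviceRate m < Q.serviceRate u ∨ Q.excessCost k₀ η n u < Q.excessCost k₀ η n m)

theorem isBetterAction_add_single (hmu : 0 < Q.mu k₀) (n : ℕ) (m : Fin K → ℕ) :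
    Q.IsBetterAction k₀ η n m (m + Pi.single k₀ 1) := by
  have hs : Q.serviceRate m < Q.serviceRate (m + Pi.single k₀ 1) := by
    rw [serviceRate_add, serviceRate_single, Nat.cast_one, one_mul]
    exact lt_add_of_pos_right _ hmu
  refine ⟨hs.le, le_of_eq ?_, Or.inl hs⟩
  rw [excessCost_add_single, div_mul_cancel₀ _ hmu.ne', sub_self, add_zero]

theorem IsMostEfficient.isBetterAction_swap (h₀ : Q.IsMostEfficient k₀) (hmu : ∀ k, 0 < Q.mu k)
    (n : ℕ) (v : Fin K → ℕ) {k : Fin K} (hk : k ≠ k₀) :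
    Q.IsBetterAction k₀ η n (v + Pi.single k 1) (v + Pi.single k₀ 1) := by
  have hprice := h₀.price_mul_le hmu k
  have hself : Q.c k₀ / Q.mu k₀ * Q.mu k₀ = Q.c k₀ := div_mul_cancel₀ _ (hmu k₀).ne'
  simp only [IsBetterAction, serviceRate_add, serviceRate_single, excessCost_add_single,
    Nat.cast_one, one_mul, add_le_add_iff_left, add_lt_add_iff_left, hself, sub_self, sub_nonneg,
    sub_pos]
  refine ⟨h₀.mu_le k, hprice, ?_⟩
  by_contra! h
  have hmueq : Q.mu k = Q.mu k₀ := (h₀.mu_le k).antisymm h.1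
  rw [hmueq, hself] at hprice h
  exact hk (h₀.eq_of_eq k hmueq (h.2.antisymm hprice))

theorem IsMostEfficient.exists_isBetterAction (h₀ : Q.IsMostEfficient k₀)
    (hmu : ∀ k, 0 < Q.mu k) {n : ℕ} {m : Fin K → ℕ} (hm : Q.IsFeasible n m)
    (hlt : m k₀ < min (Q.M k₀) n) : ∃ u, Q.IsFeasible n u ∧ Q.IsBetterAction k₀ η n m u := by
  rw [lt_min_iff] at hlt
  rcases hm.2.lt_or_eq with hidle | hbusy
  · exact ⟨_, isFeasible_add_single hm.1 hlt.1 hidle, isBetterAction_add_single (hmu k₀) n m⟩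
  · obtain ⟨k, hk, hmk⟩ : ∃ k, k ≠ k₀ ∧ m k ≠ 0 := by
      by_contra! h
      exact hlt.2.ne ((Finset.sum_eq_single k₀ (fun k _ => h k) (by simp)).symm.trans hbusy)
    obtain ⟨v, rfl⟩ : ∃ v, m = v + Pi.single k 1 := by
      refine ⟨m - Pi.single k 1, (tsub_add_cancel_of_le fun j => ?_).symm⟩
      rcases eq_or_ne j k with rfl | hj
      · simpa using Nat.one_le_iff_ne_zero.2 hmk
      · simp [hj]
    refine ⟨_, isFeasible_add_single (fun j => ?_) ?_ ?_, h₀.isBetterAction_swap hmu n v hk⟩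
    · exact (Nat.le_add_right _ _).trans (hm.1 j)
    · exact (Nat.le_add_right _ _).trans_lt hlt.1
    · simp only [Pi.add_apply, Finset.sum_add_distrib, Finset.sum_pi_single', Finset.mem_univ,
        if_true] at hbusy
      omega

end ExcessCost

namespace IsSteadyState

variable {k₀ : Fin K} {α : ℕ → ℝ} {η : ℝ} {m : ℕ}

theorem hasSum_excessCost (hα : Q.IsSteadyState d α η) (hd : d ∈ Q.efficientPolicies)
    (k₀ : Fin K) : HasSum (fun n => α n * Q.excessCost k₀ η n (d n)) 0 := by
  have hs := hα.balance.hasSum_death_mul (serviceRate_apply_zero hd) (hα.hasSum_one.mul_left Q.lam)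
  have h := (hα.hasSum_cost.sub (hα.hasSum_one.mul_left η)).sub
    ((hs.sub (hα.hasSum_one.mul_left Q.lam)).mul_left (Q.c k₀ / Q.mu k₀))
  simp only [mul_one, sub_self, mul_zero] at h
  refine h.congr_fun fun n => ?_
  rw [excessCost]
  ring

-- Otherwise no state from `m` on has a negative excess cost and one of them has a positive one, so
-- that the mean could not be zero.
theorem h_add_lt_of_head_nonneg (hα : Q.IsSteadyState d α η) (hQ : Q.Regular)
    (h₀ : Q.IsMostEfficient k₀) (hd : d ∈ Q.efficientPolicies) (hm : 0 < α m)
    (hhead : 0 ≤ ∑ n ∈ Finset.range m, α n * Q.excessCost k₀ η n (d n)) :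
    Q.h m + Q.c k₀ / Q.mu k₀ * Q.lam < η := by
  by_contra! hge
  obtain ⟨N, hN, hmN⟩ :=
    ((hQ.h_tendsto.eventually_gt_atTop (Q.h m)).and (eventually_ge_atTop m)).exists
  have hle : ∀ n, Q.h n - Q.h m ≤ Q.excessCost k₀ η n (d n) := fun n =>
    (by linarith : _ ≤ _).trans (h₀.le_excessCost hQ.mu_pos n (d n))
  have htail : ∀ n ∉ Finset.range m, 0 ≤ α n * Q.excessCost k₀ η n (d n) := fun n hn =>
    mul_nonneg (hα.nonneg n)
      ((sub_nonneg.2 (hQ.h_mono (not_lt.1 (mt Finset.mem_range.2 hn)))).trans (hle n))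
  have hsum := sum_le_hasSum (insert N (Finset.range m))
    (fun n hn => htail n fun h => hn (Finset.mem_insert_of_mem h)) (hα.hasSum_excessCost hd k₀)
  rw [Finset.sum_insert (by simpa using hmN)] at hsum
  have hαN : 0 < α N := hα.balance.pos_of_le (fun _ => hQ.lam_pos) hα.nonneg hm hmN
  have : 0 < α N * Q.excessCost k₀ η N (d N) :=
    mul_pos hαN ((sub_pos.2 hN).trans_le (hle N))
  linarith

theorem exists_first_pos (hα : Q.IsSteadyState d α η) : ∃ m, 0 < α m ∧ ∀ n < m, α n = 0 := by
  classical
  have hex : ∃ m, α m ≠ 0 := by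
    by_contra! h
    exact zero_ne_one (hasSum_zero.unique ((funext h : α = 0) ▸ hα.hasSum_one))
  exact ⟨Nat.find hex, (hα.nonneg _).lt_of_ne' (Nat.find_spec hex),
    fun n hn => not_not.1 (Nat.find_min hex hn)⟩

end IsSteadyState

theorem exists_hasAverageCost_lt (hQ : Q.Regular) (hd : d ∈ Q.efficientPolicies) {k₀ : Fin K}
    {η : ℝ} (h : HasNegativeMean (fun _ => Q.lam) (fun n => Q.serviceRate (d n))
      fun n => Q.excessCost k₀ η n (d n)) :
    ∃ η' < η, Q.HasAverageCost d η' := by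
  obtain ⟨β, hpos, hbal, ⟨B, hB⟩, W, hW, hexcess⟩ := h
  have hB0 : 0 < B := (hpos 0).trans_le (le_hasSum hB 0 fun n _ => (hpos n).le)
  have hs := hbal.hasSum_death_mul (serviceRate_apply_zero hd) (hB.mul_left Q.lam)
  have hcost : HasSum (fun n => β n * Q.cost n (d n)) (W + η * B) := by
    have hsum := (hexcess.add (hB.mul_left η)).add
      ((hs.sub (hB.mul_left Q.lam)).mul_left (Q.c k₀ / Q.mu k₀))
    rw [sub_self, mul_zero, add_zero] at hsum
    refine hsum.congr_fun fun n => ?_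
    simp only [excessCost]
    ring
  have hsteady : Q.IsSteadyState d (fun n => β n / B) ((W + η * B) / B) :=
    { nonneg := fun n => (div_pos (hpos n) hB0).le
      balance := fun n => by rw [← mul_div_assoc, ← mul_div_assoc, hbal n]
      hasSum_one := by simpa only [div_self hB0.ne'] using hB.div_const B
      hasSum_cost := by simpa only [div_mul_eq_mul_div] using hcost.div_const B }
  refine ⟨_, ?_, hsteady.hasAverageCost hQ hd fun n => div_pos (hpos n) hB0⟩
  rw [div_lt_iff₀ hB0]
  exact add_lt_of_neg_left _ hW

/-- The policy that up to state `m` uses group `k₀` only, as much as possible, and agrees with `d`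
above `m`. -/
def boost (Q : GroupQueue K) (k₀ : Fin K) (d : Policy K) (m : ℕ) : Policy K := fun n =>
  if n ≤ m then Pi.single k₀ (min (Q.M k₀) n) else d n

section Boost

variable {k₀ : Fin K} {m n : ℕ}

theorem boost_of_le (h : n ≤ m) : Q.boost k₀ d m n = Pi.single k₀ (min (Q.M k₀) n) := if_pos h

theorem boost_of_lt (h : m < n) : Q.boost k₀ d m n = d n := if_neg h.not_ge

theorem boost_mem_efficientPolicies (hd : d ∈ Q.efficientPolicies) (k₀ : Fin K) (m : ℕ) :
    Q.boost k₀ d m ∈ Q.efficientPolicies := fun n => by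
  rcases le_or_gt n m with h | h
  · rw [boost_of_le h]
    exact isFeasible_single_min k₀ n
  · rw [boost_of_lt h]
    exact hd n

end Boost

namespace IsSteadyState

variable {k₀ : Fin K} {α : ℕ → ℝ} {η : ℝ} {m : ℕ} (hα : Q.IsSteadyState d α η) (hQ : Q.Regular)
  (hd : d ∈ Q.efficientPolicies)
include hα hQ hd

theorem exists_boost_lt (h₀ : Q.IsMostEfficient k₀) (h0m : 0 < m) (hm : 0 < α m)
    (hhead : 0 ≤ ∑ n ∈ Finset.range m, α n * Q.excessCost k₀ η n (d n)) :
    ∃ η' < η, Q.HasAverageCost (Q.boost k₀ d m) η' := by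
  have hmu := (hQ.mu_pos k₀).ne'
  refine exists_hasAverageCost_lt hQ (boost_mem_efficientPolicies hd k₀ m)
    (hα.balance.hasNegativeMean_of_head_nonneg (fun _ => hQ.lam_pos) hα.nonneg
      hα.hasSum_one.summable (hα.hasSum_excessCost hd k₀) h0m hm hhead
      (fun n hn => ?_) (fun n hn => by rw [boost_of_lt hn]) (fun n hn => ?_) ?_
      (fun n hn => by rw [boost_of_lt hn]))
  · rw [boost_of_le hn, serviceRate_single]
    exact mul_pos (Nat.cast_pos.2 (lt_min h₀.M_pos n.succ_pos)) (hQ.mu_pos k₀)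
  · rw [boost_of_le hn.le, excessCost_single_self hmu]
    linarith [hα.h_add_lt_of_head_nonneg hQ h₀ hd hm hhead, hQ.h_mono hn.le]
  · rw [boost_of_le le_rfl, excessCost_single_self hmu]
    exact h₀.le_excessCost hQ.mu_pos m (d m)

theorem exists_update_lt (hpos : ∀ n, 0 < α n)
    (hhead : ∑ n ∈ Finset.range m, α n * Q.excessCost k₀ η n (d n) < 0) {u : Fin K → ℕ}
    (hu : Q.IsFeasible m u) (hbetter : Q.IsBetterAction k₀ η m (d m) u) :
    ∃ η' < η, Q.HasAverageCost (Function.update d m u) η' := by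
  obtain ⟨hs, hc, hlt⟩ := hbetter
  refine exists_hasAverageCost_lt hQ (update_mem_efficientPolicies hd hu) (k₀ := k₀) ?_
  simp only [Function.apply_update (fun _ => Q.serviceRate),
    Function.apply_update (fun n => Q.excessCost k₀ η n)]
  exact hα.balance.hasNegativeMean_update (fun _ => hQ.lam_pos) hpos hα.hasSum_one.summable
    (hα.hasSum_excessCost hd k₀) hhead hs hc hlt

theorem pos_of_forall_boost (h₀ : Q.IsMostEfficient k₀)
    (hopt : ∀ m a, Q.HasAverageCost (Q.boost k₀ d m) a → η ≤ a) (n : ℕ) : 0 < α n := by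
  obtain ⟨m, hm, hzero⟩ := hα.exists_first_pos
  rcases m.eq_zero_or_pos with rfl | h0m
  · exact hα.balance.pos_of_le (fun _ => hQ.lam_pos) hα.nonneg hm n.zero_le
  · have hhead : ∑ n ∈ Finset.range m, α n * Q.excessCost k₀ η n (d n) = 0 :=
      Finset.sum_eq_zero fun n hn => by rw [hzero n (Finset.mem_range.1 hn), zero_mul]
    obtain ⟨η', hη', ha⟩ := hα.exists_boost_lt hQ hd h₀ h0m hm hhead.ge
    exact absurd (hopt m η' ha) hη'.not_ge

end IsSteadyState

namespace IsOptimal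

variable {k₀ : Fin K} (hopt : Q.IsOptimal d) (hQ : Q.Regular) (h₀ : Q.IsMostEfficient k₀)
include hopt hQ h₀

theorem exists_isSteadyState :
    ∃ α η, Q.IsSteadyState d α η ∧ (∀ n, 0 < α n) ∧
      ∀ d' ∈ Q.efficientPolicies, ∀ a, Q.HasAverageCost d' a → η ≤ a := by
  obtain ⟨hd, a, ha, hmin⟩ := hopt
  obtain ⟨α, η, hα, hle⟩ := ha.exists_isSteadyState hQ hd
  have hη : ∀ d' ∈ Q.efficientPolicies, ∀ a', Q.HasAverageCost d' a' → η ≤ a' :=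
    fun d' hd' a' ha' => hle.trans (hmin d' hd' a' ha')
  exact ⟨α, η, hα, hα.pos_of_forall_boost hQ hd h₀ fun m =>
    hη _ (boost_mem_efficientPolicies hd k₀ m), hη⟩

theorem apply_eq_min {n : ℕ} (hn : 0 < n) : d n k₀ = min (Q.M k₀) n := by
  obtain ⟨α, η, hα, hpos, hmin⟩ := hopt.exists_isSteadyState hQ h₀
  have hd := hopt.1
  have hhead : ∑ j ∈ Finset.range n, α j * Q.excessCost k₀ η j (d j) < 0 := by
    by_contra! hge
    obtain ⟨η', hη', ha⟩ := hα.exists_boost_lt hQ hd h₀ hn (hpos n) hge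
    exact hη'.not_ge (hmin _ (boost_mem_efficientPolicies hd k₀ n) η' ha)
  have hle : d n k₀ ≤ min (Q.M k₀) n := le_min ((hd n).1 k₀)
    ((Finset.single_le_sum (fun k _ => Nat.zero_le (d n k)) (Finset.mem_univ k₀)).trans (hd n).2)
  by_contra hne
  obtain ⟨u, hu, hbetter⟩ := h₀.exists_isBetterAction hQ.mu_pos (hd n) (hle.lt_of_ne hne)
  obtain ⟨η', hη', ha⟩ := hα.exists_update_lt hQ hd hpos hhead hu hbetter
  exact hη'.not_ge (hmin _ (update_mem_efficientPolicies hd hu) η' ha)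

theorem lt_potential_diff {a : ℝ} (ha : Q.HasAverageCost d a) {g : ℕ → ℝ}
    (hg : Q.IsPotential d a g) : Q.c k₀ / Q.mu k₀ < g 1 - g 0 := by
  obtain ⟨α, η, hα, hpos, hmin⟩ := hopt.exists_isSteadyState hQ h₀
  have hh := hα.h_add_lt_of_head_nonneg hQ h₀ hopt.1 (hpos 0) (by simp)
  have hle := hmin d hopt.1 a ha
  have hpoisson : Q.h 0 - a + Q.lam * (g 1 - g 0) = 0 := by
    simpa [gen, cost, serviceRate, eq_zero_of_mem_efficientPolicies hopt.1] using hg 0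
  refine lt_of_mul_lt_mul_right ?_ hQ.lam_pos.le
  linarith

end IsOptimal

section Threshold

theorem thresholdPolicy_eq_zero {θ : Fin K → ℕ} {n : ℕ} {k : Fin K} (h : n < θ k) :
    Q.thresholdPolicy θ n k = 0 := by
  rw [thresholdPolicy_eq, if_neg h.not_ge]

theorem thresholdPolicy_mem_efficientPolicies (θ : Fin K → ℕ) :
    Q.thresholdPolicy θ ∈ Q.efficientPolicies := by
  refine fun n => ⟨fun k => ?_, ?_⟩
  · rw [thresholdPolicy_eq]
    split_ifs
    exacts [min_le_left _ _, Nat.zero_le _]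
  · refine Finset.induction_on_max Finset.univ
      (motive := fun s => ∑ k ∈ s, Q.thresholdPolicy θ n k ≤ n) (by simp) fun k s hs ih => ?_
    have hsum : ∑ l ∈ s, Q.thresholdPolicy θ n l ≤ ∑ l ∈ Finset.Iio k, Q.thresholdPolicy θ n l :=
      Finset.sum_le_sum_of_subset fun l hl => Finset.mem_Iio.2 (hs l hl)
    have hk : Q.thresholdPolicy θ n k ≤ n - ∑ l ∈ Finset.Iio k, Q.thresholdPolicy θ n l := by
      rw [thresholdPolicy_eq]
      split_ifs
      exacts [min_le_right _ _, Nat.zero_le _]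
    rw [Finset.sum_insert fun h => (hs k h).false]
    omega

variable [NeZero K] {θ : Fin K → ℕ}

theorem thresholdPolicy_zero (n : ℕ) :
    Q.thresholdPolicy θ n 0 = if θ 0 ≤ n then min (Q.M 0) n else 0 := by
  have h : Finset.Iio (0 : Fin K) = ∅ := by
    ext l
    simp
  rw [thresholdPolicy_eq, h, Finset.sum_empty, Nat.sub_zero]

theorem boost_thresholdPolicy (hmono : Monotone θ) (hθ : 0 < θ 0) :
    Q.boost 0 (Q.thresholdPolicy θ) (θ 0 - 1) = Q.thresholdPolicy (Function.update θ 0 1) := by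
  funext n k
  rcases le_or_gt n (θ 0 - 1) with hn | hn
  · rw [boost_of_le hn]
    rcases eq_or_ne k 0 with rfl | hk
    · rw [thresholdPolicy_zero, Function.update_self, Pi.single_eq_same]
      split_ifs with h
      · rfl
      · simp [show n = 0 by omega]
    · have := hmono (Fin.zero_le k)
      rw [Pi.single_eq_of_ne hk, thresholdPolicy_eq_zero]
      rw [Function.update_of_ne hk]
      omega
  · rw [boost_of_lt hn]
    induction k using WellFoundedLT.induction with
    | ind k ih =>
      rw [thresholdPolicy_eq, thresholdPolicy_eq Q (Function.update θ 0 1),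
        Finset.sum_congr rfl fun l hl => ih l (Finset.mem_Iio.1 hl)]
      rcases eq_or_ne k 0 with rfl | hk
      · rw [Function.update_self, if_pos (by omega), if_pos (by omega)]
      · rw [Function.update_of_ne hk]

theorem update_zero_one_mem_thresholdVectors (hθ : θ ∈ thresholdVectors K) :
    Function.update θ 0 1 ∈ thresholdVectors K := by
  refine ⟨fun k => ?_, fun k l hkl => ?_⟩
  · rcases eq_or_ne k 0 with rfl | hk
    · simp
    · simpa [hk] using hθ.1 k
  · rcases eq_or_ne k 0 with rfl | hk
    · rcases eq_or_ne l 0 with rfl | hl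
      · rfl
      · simpa [hl] using hθ.1 l
    · have hl : l ≠ 0 := fun h => hk (le_antisymm (h ▸ hkl) (Fin.zero_le k))
      simpa [hk, hl] using hθ.2 hkl

-- Without service below `θ 0` the states below `θ 0 - 1` are transient.
theorem IsSteadyState.first_pos_thresholdPolicy {α : ℕ → ℝ} {η : ℝ}
    (hα : Q.IsSteadyState (Q.thresholdPolicy θ) α η) (hQ : Q.Regular) (hM : 0 < Q.M 0)
    (hmono : Monotone θ) : 0 < α (θ 0 - 1) ∧ ∀ n < θ 0 - 1, α n = 0 := by
  obtain ⟨m, hm, hzero⟩ := hα.exists_first_pos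
  have hmθ : m ≤ θ 0 - 1 := by
    by_contra! hlt
    obtain ⟨p, rfl⟩ := Nat.exists_eq_add_one.2 ((Nat.zero_le _).trans_lt hlt)
    have hserve : 0 < Q.serviceRate (Q.thresholdPolicy θ (p + 1)) := by
      refine Finset.sum_pos' (fun k _ => mul_nonneg (Nat.cast_nonneg _) (hQ.mu_pos k).le)
        ⟨0, Finset.mem_univ 0, mul_pos (Nat.cast_pos.2 ?_) (hQ.mu_pos 0)⟩
      rw [thresholdPolicy_zero, if_pos (by omega)]
      exact lt_min hM p.succ_pos
    have hbal := hα.balance p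
    rw [hzero p p.lt_succ_self, mul_zero] at hbal
    exact (mul_pos hserve hm).ne hbal
  refine ⟨hα.balance.pos_of_le (fun _ => hQ.lam_pos) hα.nonneg hm hmθ, fun n hn => ?_⟩
  have hoff : Q.serviceRate (Q.thresholdPolicy θ (n + 1)) = 0 :=
    Finset.sum_eq_zero fun k _ => by
      have := hmono (Fin.zero_le k)
      rw [thresholdPolicy_eq_zero (by omega), Nat.cast_zero, zero_mul]
  have hbal : Q.lam * α n = Q.serviceRate (Q.thresholdPolicy θ (n + 1)) * α (n + 1) := hα.balance n
  rw [hoff, zero_mul] at hbal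
  exact (mul_eq_zero.1 hbal).resolve_left hQ.lam_pos.ne'

theorem IsOptimalThreshold.zero_eq_one (hopt : Q.IsOptimalThreshold θ) (hQ : Q.Regular)
    (h₀ : Q.IsMostEfficient 0) : θ 0 = 1 := by
  obtain ⟨hθ, a, ha, hmin⟩ := hopt
  by_contra hne
  have hpos : 0 < θ 0 := hθ.1 0
  have hd := thresholdPolicy_mem_efficientPolicies (Q := Q) θ
  obtain ⟨α, η, hα, hle⟩ := ha.exists_isSteadyState hQ hd
  obtain ⟨hm, hzero⟩ := hα.first_pos_thresholdPolicy hQ h₀.M_pos hθ.2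
  have hhead : ∑ n ∈ Finset.range (θ 0 - 1),
      α n * Q.excessCost 0 η n (Q.thresholdPolicy θ n) = 0 :=
    Finset.sum_eq_zero fun n hn => by rw [hzero n (Finset.mem_range.1 hn), zero_mul]
  obtain ⟨η', hη', ha'⟩ := hα.exists_boost_lt hQ hd h₀ (by omega) hm hhead.ge
  rw [boost_thresholdPolicy hθ.2 hpos] at ha'
  exact (hη'.trans_le hle).not_ge (hmin _ (update_zero_one_mem_thresholdVectors hθ) η' ha')

end Threshold

end GroupQueue

theorem theorem10_general {K : ℕ} [NeZero K] (Q : GroupQueue K) (hQ : Q.Regular)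
    (h₀ : Q.IsMostEfficient 0) :
    (∀ θ : Fin K → ℕ, Q.IsOptimalThreshold θ → θ 0 = 1) ∧
    (∀ (d : GroupQueue.Policy K) (a : ℝ) (g : ℕ → ℝ),
      Q.IsOptimal d → Q.HasAverageCost d a → Q.IsPotential d a g →
        IsLeast {n : ℕ | 1 ≤ n ∧ Q.c 0 / Q.mu 0 < g n - g (n - 1)} 1) ∧
    (∀ d : GroupQueue.Policy K, Q.IsOptimal d → ∀ n : ℕ, 1 ≤ n → d n 0 = min (Q.M 0) n) :=
  ⟨fun _ hθ => hθ.zero_eq_one hQ h₀,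
    fun _ _ _ hd ha hg => ⟨⟨le_rfl, hd.lt_potential_diff hQ h₀ ha hg⟩, fun _ hn => hn.1⟩,
    fun _ hd _ hn => hd.apply_eq_min hQ h₀ hn⟩

theorem theorem10 {K : ℕ} [NeZero K] (Q : GroupQueue K) (hQ : Q.Standing)
    (hS : Q.ScaleEconomies) :
    -- every optimal threshold vector has first threshold `1`
    (∀ θ : Fin K → ℕ, Q.IsOptimalThreshold θ → θ 0 = 1) ∧
    -- the optimal threshold of group 1 read off from the differences of the optimal potential is `1`
    (∀ (d : GroupQueue.Policy K) (a : ℝ) (g : ℕ → ℝ),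
      Q.IsOptimal d → Q.HasAverageCost d a → Q.IsPotential d a g →
        IsLeast {n : ℕ | 1 ≤ n ∧ Q.c 0 / Q.mu 0 < g n - g (n - 1)} 1) ∧
    -- every optimal policy uses group 1 as much as possible whenever a customer is present
    (∀ d : GroupQueue.Policy K, Q.IsOptimal d → ∀ n : ℕ, 1 ≤ n → d n 0 = min (Q.M 0) n) :=
  theorem10_general Q hQ.regular (hS.isMostEfficient_zero hQ)
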